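/- Conventions. A continuous theory is a set $\hat T$ of conditions $\varphi=0$, where $\varphi$ is a sentence of single-sorted continuous first order logic (connectives $\neg x=1-x$, $x/2$, $x\dotminus y=\max(x-y,0)$; quantifiers $\sup,\inf$) over a metric signature $\hat{\mathcal L}$: function and $[0,1]$-valued predicate symbols, each with a uniform continuity modulus in each argument, and a distinguished binary predicate symbol $\hat d$. Structures are nonempty, interpret $\hat d$ as a complete metric, and respect the moduli. $S_n(\hat T)$ is the space of types of $n$-tuples in models of $\hat T$ ($n<\omega$), with the coarsest topology making all maps $p\mapsto\varphi^p$ continuous; for $f\colon n\to m$, $f^*\colon S_m(\hat T)\to S_n(\hat T)$ sends $\mathrm{tp}(a_0,\dots,a_{m-1})$ to $\mathrm{tp}(a_{f(0)},\dots,a_{f(n-1)})$. This gives the type-space functor $S(\hat T)$. An open Hausdorff cat $T$ is presented by its type-space functor: a contravariant functor $S(T)$, $n\mapsto S_n(T)$, $f\mapsto f^*$, from the finite ordinals with all maps to compact Hausdorff spaces with continuous maps such that: (a) the restriction maps $S_{n+1}(T)\to S_n(T)$ to the first $n$ variables are open; (b) $S_1(T)\to S_0(T)$ is surjective; (c) (equality)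 call a $2$-type diagonal if it is in the image of $S_1(T)$ under the map induced by $2\to 1$; if $p\in S_n(T)$ and its restriction to the variables $x_i,x_j$ is diagonal, then $e^*p=p$, where $e\colon n\to n$ sends $j$ to $i$ and fixes everything else; (d) (amalgamation) if $f\colon n\to m$, $g\colon n\to k$, $p\in S_m(T)$, $q\in S_k(T)$ and $f^*p=g^*q$, then there is $r\in S_{m+k}(T)$ restricting to $p$ on the first $m$ variables and to $q$ on the last $k$, such that for each $i<n$ the restriction of $r$ to the variables $x_{f(i)},x_{m+g(i)}$ is diagonal. A definable $[0,1]$-valued metric on $T$ is a continuous $d\colon S_2(T)\to[0,1]$ such that $(a,b)\mapsto d(\mathrm{tp}(a,b))$ is a metric; that is, $d(p)=0$ iff $p$ is diagonal, $d$ is invariant under exchanging the two variables, and the triangle inequality holds on $S_3(T)$. A metric open Hausdorff cat is one admitting a definable metric. An isomorphism of type-space functors is a natural family of homeomorphisms. Theorem. (1) For every metric signature $\mathcal L$ with distance symbol $d$ and every continuous $\mathcal L$-theory $T$, $S(T)$ is (the type-space functor of) an open Hausdorff cat and $p\mapsto d(x_0,x_1)^p$ is a definable metric on it. (2) Let $T$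 be an open Hausdorff cat with a definable metric $d$ with values in $[0,1]$. Then there exist a metric signature $\hat{\mathcal L}$ with distance symbol $\hat d$, an $\hat{\mathcal L}$-theory $\hat T$, and an isomorphism of type-space functors $\theta\colon S(T)\to S(\hat T)$ such that $\hat d(x_0,x_1)^{\theta_2(p)}=d(p)$ for all $p\in S_2(T)$. (3) Moreover, if $\kappa$ is an infinite cardinal such that for every $n<\omega$ the space $S_n(T)$ has a basis of cardinality at most $\kappa$, then $\hat{\mathcal L}$, $\hat T$, $\theta$ in (2) can be chosen with $|\hat{\mathcal L}|\le\kappa$. Thus continuous first order theories coincide with metric open Hausdorff cats. -/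

import Mathlib

open Cardinal

universe u

namespace ContLogic

/-! ### Truth values and connectives -/

/-- The connective `x ↦ ¬ x = 1 - x` on `[0,1]`. -/
def negI (x : unitInterval) : unitInterval :=
  ⟨1 - (x : ℝ), by have := x.2; constructor <;> linarith [this.1, this.2]⟩

/-- The connective `x ↦ x / 2` on `[0,1]`. -/
noncomputable def halfI (x : unitInterval) : unitInterval :=
  ⟨(x : ℝ) / 2, by have := x.2; constructor <;> linarith [this.1, this.2]⟩

/-- Truncated subtraction `x ∸ y = max (x - y) 0` on `[0,1]`. -/
noncomputable def dotminusI (x y : unitInterval) : unitInterval :=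
  ⟨max ((x : ℝ) - y) 0, le_max_right _ _,
    max_le (by linarith [x.2.2, y.2.1]) zero_le_one⟩

/-- The supremum of a `[0,1]`-valued family (only used for nonempty index types). -/
noncomputable def supI {M : Type u} (g : M → unitInterval) : unitInterval :=
  ⟨⨆ b, (g b : ℝ), Real.iSup_nonneg fun b => (g b).2.1,
    Real.iSup_le (fun b => (g b).2.2) zero_le_one⟩

/-- The infimum of a `[0,1]`-valued family (only used for nonempty index types). -/
noncomputable def infI {M : Type u} (g : M → unitInterval) : unitInterval :=
  negI (supI fun b => negI (g b))

/-! ### Signatures, formulae, structures -/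

/-- A (single-sorted) metric continuous signature: function symbols and predicate symbols (the
`Relations` of the underlying `Language`) with their arities, a distinguished binary predicate
symbol, and for every symbol and every argument a continuity modulus `(0,∞) → (0,∞)`
(given as a function on `ℝ`, of which only the values at positive reals matter). -/
structure MetricSignature extends FirstOrder.Language.{u, u} where
  /-- the distance symbol -/
  dist : Relations 2
  /-- the continuity moduli of the function symbols -/
  funModulus : ∀ {k : ℕ}, Functions k → Fin k → ℝ → ℝ
  funModulus_pos : ∀ {k : ℕ} (f : Functions k) (i : Fin k) (ε : ℝ), 0 < ε → 0 < funModulus f i ε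
  /-- the continuity moduli of the predicate symbols -/
  predModulus : ∀ {k : ℕ}, Relations k → Fin k → ℝ → ℝ
  predModulus_pos : ∀ {k : ℕ} (P : Relations k) (i : Fin k) (ε : ℝ),
    0 < ε → 0 < predModulus P i ε

/-- The cardinality of a signature: the number of its function and predicate symbols. -/
noncomputable def MetricSignature.size (L : MetricSignature.{u}) : Cardinal.{u} :=
  #((Σ k : ℕ, L.Functions k) ⊕ (Σ k : ℕ, L.Relations k))

/-- `Formula L n` is the type of continuous `L`-formulae in the free variables `x_0, …, x_{n-1}`,
over the full system of connectives `¬`, `x / 2`, `∸`. A quantifier on a formula in `n + 1`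
variables binds the last variable `x_n`. -/
inductive Formula (L : MetricSignature.{u}) : ℕ → Type u
  | pred {n k : ℕ} (P : L.Relations k) (t : Fin k → L.toLanguage.Term (Fin n)) : Formula L n
  | neg {n : ℕ} (φ : Formula L n) : Formula L n
  | half {n : ℕ} (φ : Formula L n) : Formula L n
  | dotminus {n : ℕ} (φ ψ : Formula L n) : Formula L n
  | sup {n : ℕ} (φ : Formula L (n + 1)) : Formula L n
  | inf {n : ℕ} (φ : Formula L (n + 1)) : Formula L n

/-- Extends a map of variables `n → m` to `n + 1 → m + 1` by sending `x_n` to `x_m`. -/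
def liftVar {n m : ℕ} (f : Fin n → Fin m) : Fin (n + 1) → Fin (m + 1) :=
  Fin.snoc (α := fun _ => Fin (m + 1)) (fun i => (f i).castSucc) (Fin.last m)

/-- The change of variables `φ(x_0, …, x_{n-1}) ↦ φ(x_{f 0}, …, x_{f (n-1)})`. -/
def Formula.relabel {L : MetricSignature.{u}} :
    {n : ℕ} → Formula L n → {m : ℕ} → (Fin n → Fin m) → Formula L m
  | _, .pred P t, _, f => .pred P fun i => (t i).relabel f
  | _, .neg φ, _, f => .neg (φ.relabel f)
  | _, .half φ, _, f => .half (φ.relabel f)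
  | _, .dotminus φ ψ, _, f => .dotminus (φ.relabel f) (ψ.relabel f)
  | _, .sup φ, _, f => .sup (φ.relabel (liftVar f))
  | _, .inf φ, _, f => .inf (φ.relabel (liftVar f))

/-- A (continuous) `L`-structure on the nonempty set `M`: interpretations of the symbols such that
the distance symbol is interpreted by a complete metric, and each symbol respects its uniform
continuity modulus in each argument. -/
structure ContStructure (L : MetricSignature.{u}) (M : Type u) where
  nonempty : Nonempty M
  func : ∀ {k : ℕ}, L.Functions k → (Fin k → M) → M
  pred : ∀ {k : ℕ}, L.Relations k → (Fin k → M) → unitInterval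
  dist_self : ∀ a : M, (pred L.dist ![a, a] : ℝ) = 0
  dist_comm : ∀ a b : M, (pred L.dist ![a, b] : ℝ) = pred L.dist ![b, a]
  dist_triangle : ∀ a b c : M,
    (pred L.dist ![a, c] : ℝ) ≤ pred L.dist ![a, b] + pred L.dist ![b, c]
  eq_of_dist_eq_zero : ∀ a b : M, (pred L.dist ![a, b] : ℝ) = 0 → a = b
  func_uc : ∀ {k : ℕ} (f : L.Functions k) (i : Fin k) (ε : ℝ), 0 < ε →
    ∀ (a : Fin k → M) (z w : M), (pred L.dist ![z, w] : ℝ) < L.funModulus f i ε →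
      (pred L.dist ![func f (Function.update a i z), func f (Function.update a i w)] : ℝ) ≤ ε
  pred_uc : ∀ {k : ℕ} (P : L.Relations k) (i : Fin k) (ε : ℝ), 0 < ε →
    ∀ (a : Fin k → M) (z w : M), (pred L.dist ![z, w] : ℝ) < L.predModulus P i ε →
      |(pred P (Function.update a i z) : ℝ) - pred P (Function.update a i w)| ≤ ε
  complete : ∀ s : ℕ → M,
    (∀ ε : ℝ, 0 < ε → ∃ N, ∀ m ≥ N, ∀ n ≥ N, (pred L.dist ![s m, s n] : ℝ) < ε) →
    ∃ a : M, ∀ ε : ℝ, 0 < ε → ∃ N, ∀ n ≥ N, (pred L.dist ![s n, a] : ℝ) < ε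

namespace ContStructure

variable {L : MetricSignature.{u}} {M : Type u}

/-- The interpretation of a term. -/
def termVal (𝓜 : ContStructure L M) {n : ℕ} (a : Fin n → M) : L.toLanguage.Term (Fin n) → M
  | .var i => a i
  | .func f t => 𝓜.func f fun i => 𝓜.termVal a (t i)

/-- The interpretation `φ^M : M^n → [0,1]` of a formula. -/
noncomputable def eval (𝓜 : ContStructure L M) :
    {n : ℕ} → Formula L n → (Fin n → M) → unitInterval
  | _, .pred P t, a => 𝓜.pred P fun i => 𝓜.termVal a (t i)
  | _, .neg φ, a => negI (𝓜.eval φ a)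
  | _, .half φ, a => halfI (𝓜.eval φ a)
  | _, .dotminus φ ψ, a => dotminusI (𝓜.eval φ a) (𝓜.eval ψ a)
  | _, .sup φ, a => supI fun b : M => 𝓜.eval φ (Fin.snoc (α := fun _ => M) a b)
  | _, .inf φ, a => infI fun b : M => 𝓜.eval φ (Fin.snoc (α := fun _ => M) a b)

theorem termVal_relabel (𝓜 : ContStructure L M) {n m : ℕ} (f : Fin n → Fin m) (a : Fin m → M)
    (t : L.toLanguage.Term (Fin n)) :
    𝓜.termVal a (t.relabel f) = 𝓜.termVal (a ∘ f) t := by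
  induction t with
  | var i => rfl
  | func g ts ih =>
    simp only [FirstOrder.Language.Term.relabel, termVal]
    congr 1
    funext i
    exact ih i

theorem snoc_comp_liftVar {n m : ℕ} (f : Fin n → Fin m) (a : Fin m → M) (b : M) :
    (Fin.snoc (α := fun _ => M) a b) ∘ liftVar f = Fin.snoc (α := fun _ => M) (a ∘ f) b := by
  funext i
  refine Fin.lastCases ?_ (fun j => ?_) i
  · simp [liftVar]
  · simp [liftVar]

theorem eval_relabel (𝓜 : ContStructure L M) {n : ℕ} (φ : Formula L n) :
    ∀ {m : ℕ} (f : Fin n → Fin m) (a : Fin m → M),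
      𝓜.eval (φ.relabel f) a = 𝓜.eval φ (a ∘ f) := by
  induction φ with
  | pred P t => intro m f a; simp only [Formula.relabel, eval, termVal_relabel]
  | neg φ ih => intro m f a; simp only [Formula.relabel, eval, ih]
  | half φ ih => intro m f a; simp only [Formula.relabel, eval, ih]
  | dotminus φ ψ ih₁ ih₂ => intro m f a; simp only [Formula.relabel, eval, ih₁, ih₂]
  | sup φ ih => intro m f a; simp only [Formula.relabel, eval, ih, snoc_comp_liftVar]
  | inf φ ih => intro m f a; simp only [Formula.relabel, eval, ih, snoc_comp_liftVar]

/-- `𝓜` is a model of the theory `T`, a set of sentences `φ` standing for the conditions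
`φ = 0`. -/
def Models (𝓜 : ContStructure L M) (T : Set (Formula L 0)) : Prop :=
  ∀ φ ∈ T, 𝓜.eval φ Fin.elim0 = 0

end ContStructure

/-! ### Type-space functors -/

/-- The data of a type-space functor: a contravariant functor from finite ordinals and
arbitrary maps to topological spaces and continuous maps. For `f : n → m`, the map
`map f : S_m → S_n` is the map usually denoted by `f^*`. -/
structure TypeFunctor where
  space : ℕ → Type u
  top : ∀ n, TopologicalSpace (space n)
  map : ∀ {n m : ℕ}, (Fin n → Fin m) → space m → space n
  map_continuous : ∀ {n m : ℕ} (f : Fin n → Fin m), Continuous (map f)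
  map_id : ∀ {n : ℕ} (p : space n), map id p = p
  map_comp : ∀ {n m k : ℕ} (f : Fin n → Fin m) (g : Fin m → Fin k) (p : space k),
    map (g ∘ f) p = map f (map g p)

namespace TypeFunctor

attribute [instance] TypeFunctor.top

/-- A `2`-type is diagonal if it is the type of a pair `(a, a)`, i.e., if it contains the
equality `x_0 = x_1`. -/
def IsDiagonal (S : TypeFunctor.{u}) (p : S.space 2) : Prop :=
  p ∈ Set.range (S.map (fun _ : Fin 2 => (0 : Fin 1)))

/-- The functor is an open Hausdorff cat, i.e., an open compact Hausdorff type-space functor. -/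
structure IsOpenHausdorffCat (S : TypeFunctor.{u}) : Prop where
  compact : ∀ n, CompactSpace (S.space n)
  hausdorff : ∀ n, T2Space (S.space n)
  /-- Open: restriction to the first `n` variables is an open map. -/
  isOpenMap : ∀ n, IsOpenMap (S.map (Fin.castSucc : Fin n → Fin (n + 1)))
  /-- Every `0`-type extends to a `1`-type (universal domains are nonempty). -/
  surjective : Function.Surjective (S.map (Fin.elim0 : Fin 0 → Fin 1))
  /-- Equality: if `p(x_0, …, x_{n-1})` contains `x_i = x_j`, then replacing the variable `x_j` by
  `x_i` does not change `p`. -/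
  equality : ∀ {n : ℕ} (p : S.space n) (i j : Fin n), S.IsDiagonal (S.map ![i, j] p) →
    S.map (Function.update id j i) p = p
  /-- Amalgamation: if the subtuple `f` of `p` and the subtuple `g` of `q` have the same type, then
  `p` and `q` have a common extension in which these two subtuples are equal. -/
  amalgamation : ∀ {n m k : ℕ} (f : Fin n → Fin m) (g : Fin n → Fin k)
    (p : S.space m) (q : S.space k), S.map f p = S.map g q →
    ∃ r : S.space (m + k), S.map (Fin.castAdd k) r = p ∧ S.map (Fin.natAdd m) r = q ∧
      ∀ i : Fin n, S.IsDiagonal (S.map ![Fin.castAdd k (f i), Fin.natAdd m (g i)] r)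

/-- A `[0,1]`-valued definable metric: a continuous function `d : S_2 → [0,1]` such that
`(a, b) ↦ d (tp (a, b))` is a metric. Since every type is realised, the metric axioms are stated
for the types of pairs and triples. -/
structure IsDefinableMetric (S : TypeFunctor.{u}) (d : S.space 2 → unitInterval) : Prop where
  continuous : Continuous d
  eq_zero_iff : ∀ p : S.space 2, d p = 0 ↔ S.IsDiagonal p
  symm : ∀ p : S.space 2, d (S.map ![1, 0] p) = d p
  triangle : ∀ p : S.space 3,
    (d (S.map ![0, 2] p) : ℝ) ≤ d (S.map ![0, 1] p) + d (S.map ![1, 2] p)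

/-- An isomorphism of type-space functors: a natural family of homeomorphisms. -/
structure Iso (S S' : TypeFunctor.{u}) where
  homeo : ∀ n, S.space n ≃ₜ S'.space n
  natural : ∀ {n m : ℕ} (f : Fin n → Fin m) (p : S.space m),
    homeo n (S.map f p) = S'.map f (homeo m p)

end TypeFunctor

/-! ### The type spaces of a continuous theory -/

/-- The space of `n`-types of the theory `T`, with the logic topology. The type of a tuple `a` in a
model is recorded as the function `φ ↦ φ^M(a)`, so that `p.val φ` is the value `φ^p` of `φ`
according to `p`; the logic topology, the coarsest one for which all the functions `p ↦ φ^p` are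
continuous, is then the topology induced from the product topology. -/
structure TypeSpace {L : MetricSignature.{u}} (T : Set (Formula L 0)) (n : ℕ) : Type u where
  val : Formula L n → unitInterval
  realised : ∃ (M : Type u) (𝓜 : ContStructure L M) (a : Fin n → M),
    𝓜.Models T ∧ ∀ φ, val φ = 𝓜.eval φ a

theorem TypeSpace.ext {L : MetricSignature.{u}} {T : Set (Formula L 0)} {n : ℕ}
    {p q : TypeSpace T n} (h : ∀ φ, p.val φ = q.val φ) : p = q := by
  cases p
  cases q
  congr
  exact funext h

instance {L : MetricSignature.{u}} (T : Set (Formula L 0)) (n : ℕ) :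
    TopologicalSpace (TypeSpace T n) :=
  TopologicalSpace.induced TypeSpace.val inferInstance

/-- For `f : n → m` the map `f^* : S_m(T) → S_n(T)` with `φ^{f^* p} = φ(x_{f 0}, …, x_{f (n-1)})^p`;
it sends `tp (a_0, …, a_{m-1})` to `tp (a_{f 0}, …, a_{f (n-1)})`. -/
def TypeSpace.map {L : MetricSignature.{u}} {T : Set (Formula L 0)} {n m : ℕ}
    (f : Fin n → Fin m) (p : TypeSpace T m) : TypeSpace T n :=
  ⟨fun φ => p.val (φ.relabel f), by
    obtain ⟨M, 𝓜, a, hT, hp⟩ := p.realised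
    exact ⟨M, 𝓜, a ∘ f, hT, fun φ => by rw [hp, 𝓜.eval_relabel]⟩⟩

/-- The type-space functor `S(T)` of a continuous theory `T`. -/
def typeFunctor {L : MetricSignature.{u}} (T : Set (Formula L 0)) : TypeFunctor.{u} where
  space := TypeSpace T
  top := fun _ => inferInstance
  map := TypeSpace.map
  map_continuous := fun f => continuous_induced_rng.2
    (continuous_pi fun φ => (continuous_apply (φ.relabel f)).comp continuous_induced_dom)
  map_id := fun p => by
    obtain ⟨M, 𝓜, a, -, hp⟩ := p.realised
    refine TypeSpace.ext fun φ => ?_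
    change p.val (φ.relabel id) = p.val φ
    rw [hp, hp, 𝓜.eval_relabel, Function.comp_id]
  map_comp := fun f g p => by
    obtain ⟨M, 𝓜, a, -, hp⟩ := p.realised
    refine TypeSpace.ext fun φ => ?_
    change p.val (φ.relabel (g ∘ f)) = p.val ((φ.relabel f).relabel g)
    rw [hp, hp, 𝓜.eval_relabel, 𝓜.eval_relabel, 𝓜.eval_relabel, Function.comp_assoc]

/-- The distance symbol of the signature, as the function `p ↦ d(x_0, x_1)^p` on `S_2(T)`. -/
def typeDist {L : MetricSignature.{u}} (T : Set (Formula L 0))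
    (p : (typeFunctor T).space 2) : unitInterval :=
  p.val (.pred L.dist fun i => .var i)

end ContLogic

namespace ContLogic

open Filter Topology Set UniformSpace

/-! ### The connectives and quantifiers on `[0,1]` -/

/-! Part (1) is compactness in continuous logic. An ultrafilter on `S_n(T)` converges to the type of
the tuple of representatives in an ultraproduct of models; the ultraproduct is only a prestructure,
and completing it preserves the values of formulae because these are uniformly continuous
(`exists_completion`). Restriction is open because of the quantifier: a type `q` in an open set `V`
has a formula `φ` vanishing at `q` and bounded below by some `δ > 0` off `V`, and `inf φ < δ` forces
an extension into `V` inside any given model. For amalgamation, fix a model realising one of the two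
types; it realises approximations to the other over the common subtuple, and compactness yields an
exact amalgam.

For (2) and (3), take a separating family of continuous functions on the type spaces, together with
`d`, as predicate symbols. Compactness makes each uniformly continuous for `d` (`exists_modulus`),
because coordinates at distance zero are equal. Formulae become functions on the type spaces, a
quantifier being a supremum or infimum over the fibres of restriction. This is continuous since
restriction is open and the spaces are compact Hausdorff (`continuous_fiberSup`), and it commutes
with substitution by amalgamation (`fiberSup_map`). The theory consists of the sentences vanishing
on all of `S_0`.

The main difficulty is that each `p` must be the type of a tuple in a structure. A Henkin
construction adds formal witnesses for all fibrewise suprema of continuous functions. Finitely many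
of them can be handled by amalgamation, and Tychonoff's theorem gives one coherent family of types
handling all (`Witness.exists_family`). This is a prestructure in which truth agrees with the
interpretation on types; its completion is the model sought. Conversely, a tuple in a model
satisfies every condition valid on the whole compact space `S_n`, so its type comes from a point of
`S_n` (`IsValuation.exists_eq`). The resulting continuous bijections are homeomorphisms. For (3),
Urysohn functions for pairs of basic open sets already separate types. -/

theorem isLUB_supI {M : Type u} (g : M → unitInterval) : IsLUB (range g) (supI g) := by
  have hb : BddAbove (range fun b => (g b : ℝ)) := ⟨1, by rintro _ ⟨b, rfl⟩; exact (g b).2.2⟩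
  refine ⟨?_, fun c hc => ?_⟩
  · rintro _ ⟨b, rfl⟩
    exact Subtype.coe_le_coe.1 (le_ciSup hb b)
  · exact Subtype.coe_le_coe.1
      (Real.iSup_le (fun b => Subtype.coe_le_coe.2 (hc (mem_range_self b))) c.2.1)

theorem le_supI {M : Type u} (g : M → unitInterval) (b : M) : g b ≤ supI g :=
  (isLUB_supI g).1 (mem_range_self b)

theorem supI_le {M : Type u} {g : M → unitInterval} {c : unitInterval} (h : ∀ b, g b ≤ c) :
    supI g ≤ c :=
  (isLUB_supI g).2 (by rintro _ ⟨b, rfl⟩; exact h b)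

theorem exists_lt_of_lt_supI {M : Type u} {g : M → unitInterval} {c : unitInterval}
    (h : c < supI g) : ∃ b, c < g b := by
  by_contra! hc
  exact absurd h (not_lt.2 (supI_le hc))

@[simp] theorem coe_negI (x : unitInterval) : (negI x : ℝ) = 1 - x := rfl

@[simp] theorem coe_halfI (x : unitInterval) : (halfI x : ℝ) = x / 2 := rfl

@[simp] theorem coe_dotminusI (x y : unitInterval) :
    (dotminusI x y : ℝ) = max ((x : ℝ) - y) 0 := rfl

theorem negI_negI (x : unitInterval) : negI (negI x) = x := Subtype.ext (by simp)

theorem negI_le_negI {x y : unitInterval} (h : x ≤ y) : negI y ≤ negI x :=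
  Subtype.coe_le_coe.1 (sub_le_sub_left (Subtype.coe_le_coe.2 h) 1)

theorem infI_le {M : Type u} (g : M → unitInterval) (b : M) : infI g ≤ g b := by
  have := negI_le_negI (le_supI (fun b => negI (g b)) b)
  rwa [negI_negI] at this

theorem exists_lt_of_infI_lt {M : Type u} {g : M → unitInterval} {c : unitInterval}
    (h : infI g < c) : ∃ b, g b < c := by
  by_contra! hc
  refine absurd h (not_lt.2 ?_)
  have := negI_le_negI (supI_le fun b => negI_le_negI (hc b))
  rwa [negI_negI] at this

theorem dist_unitInterval (x y : unitInterval) : dist x y = |(x : ℝ) - y| := rfl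

theorem dist_negI (x y : unitInterval) : dist (negI x) (negI y) = dist x y := by
  simp only [dist_unitInterval, coe_negI]
  rw [abs_sub_comm (x : ℝ)]
  congr 1
  ring

theorem uniformContinuous_negI : UniformContinuous negI :=
  (Isometry.of_dist_eq dist_negI).uniformContinuous

theorem uniformContinuous_halfI : UniformContinuous halfI := by
  refine (LipschitzWith.of_dist_le_mul (K := 1) fun x y => ?_).uniformContinuous
  simp only [dist_unitInterval, coe_halfI, NNReal.coe_one, one_mul]
  rw [← sub_div, abs_div, abs_two]
  linarith [abs_nonneg ((x : ℝ) - y)]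

theorem uniformContinuous_dotminusI :
    UniformContinuous fun z : unitInterval × unitInterval => dotminusI z.1 z.2 := by
  refine CompactSpace.uniformContinuous_of_continuous (Continuous.subtype_mk ?_ _)
  fun_prop

theorem dist_supI_le {M : Type u} {g h : M → unitInterval} {ε : ℝ} (hε : 0 ≤ ε)
    (H : ∀ b, dist (g b) (h b) ≤ ε) : dist (supI g) (supI h) ≤ ε := by
  have key : ∀ {g h : M → unitInterval}, (∀ b, dist (g b) (h b) ≤ ε) →
      (supI g : ℝ) ≤ supI h + ε := by
    intro g h H
    refine Real.iSup_le (fun b => ?_) (add_nonneg (supI h).2.1 hε)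
    have h1 := (abs_le.1 (H b)).2
    have h2 : (h b : ℝ) ≤ supI h := le_supI h b
    linarith
  rw [dist_unitInterval, abs_le]
  have h1 := key H
  have h2 := key (g := h) (h := g) fun b => by rw [dist_comm]; exact H b
  constructor <;> linarith

/-- Uniform continuity in each argument implies uniform continuity. -/
theorem uniformContinuous_of_update {M Y : Type*} [PseudoMetricSpace M] [PseudoMetricSpace Y]
    {k : ℕ} {F : (Fin k → M) → Y}
    (H : ∀ (i : Fin k) (ε : ℝ), 0 < ε → ∃ δ > 0, ∀ (a : Fin k → M) (z w : M), dist z w < δ →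
      dist (F (Function.update a i z)) (F (Function.update a i w)) ≤ ε) :
    UniformContinuous F := by
  rw [Metric.uniformContinuous_iff]
  intro ε hε
  -- Coordinates are changed one at a time, so the total change is at most `k * η`; the denominator
  -- `k + 1` makes this less than `ε` and covers `k = 0`.
  set η : ℝ := ε / (k + 1) with hη
  have hk : (0 : ℝ) < k + 1 := by positivity
  have hη0 : 0 < η := by positivity
  choose δ hδ hF using fun i => H i η hη0
  obtain ⟨δ', h⟩ := (eventually_all.2 fun i => Ioc_mem_nhdsGT (hδ i)).and
    (self_mem_nhdsWithin (s := Ioi (0 : ℝ)) (a := 0)) |>.exists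
  obtain ⟨hle, hδ'⟩ := h
  refine ⟨δ', hδ', fun a b hab => ?_⟩
  -- The hybrid tuples `s.piecewise b a` interpolate from `a` to `b`.
  have key : ∀ s : Finset (Fin k), dist (F a) (F (s.piecewise b a)) ≤ s.card * η := by
    intro s
    induction s using Finset.induction_on with
    | empty => simp
    | insert j s hj ih =>
      rw [Finset.piecewise_insert, Finset.card_insert_of_notMem hj]
      have h1 : s.piecewise b a = Function.update (s.piecewise b a) j (a j) := by
        rw [eq_comm, Function.update_eq_self_iff]
        simp [hj]
      have h2 := hF j (s.piecewise b a) (a j) (b j)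
        (lt_of_le_of_lt (dist_le_pi_dist a b j) (hab.trans_le (hle j).2))
      rw [← h1] at h2
      have := dist_triangle (F a) (F (s.piecewise b a))
        (F (Function.update (s.piecewise b a) j (b j)))
      push_cast
      linarith
  have := key Finset.univ
  rw [Finset.piecewise_univ, Finset.card_univ, Fintype.card_fin] at this
  refine this.trans_lt ?_
  rw [hη, mul_div_assoc', div_lt_iff₀ hk]
  linarith

/-! ### Prestructures and their completions -/

/-- A prestructure: like a structure, but the distance symbol is only required to be a
pseudometric. -/
structure PreStructure (L : MetricSignature.{u}) (M : Type u) where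
  nonempty : Nonempty M
  func : ∀ {k : ℕ}, L.Functions k → (Fin k → M) → M
  pred : ∀ {k : ℕ}, L.Relations k → (Fin k → M) → unitInterval
  dist_self : ∀ a : M, (pred L.dist ![a, a] : ℝ) = 0
  dist_comm : ∀ a b : M, (pred L.dist ![a, b] : ℝ) = pred L.dist ![b, a]
  dist_triangle : ∀ a b c : M,
    (pred L.dist ![a, c] : ℝ) ≤ pred L.dist ![a, b] + pred L.dist ![b, c]
  func_uc : ∀ {k : ℕ} (f : L.Functions k) (i : Fin k) (ε : ℝ), 0 < ε →
    ∀ (a : Fin k → M) (z w : M), (pred L.dist ![z, w] : ℝ) < L.funModulus f i ε →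
      (pred L.dist ![func f (Function.update a i z), func f (Function.update a i w)] : ℝ) ≤ ε
  pred_uc : ∀ {k : ℕ} (P : L.Relations k) (i : Fin k) (ε : ℝ), 0 < ε →
    ∀ (a : Fin k → M) (z w : M), (pred L.dist ![z, w] : ℝ) < L.predModulus P i ε →
      |(pred P (Function.update a i z) : ℝ) - pred P (Function.update a i w)| ≤ ε

/-- A structure, regarded as a prestructure. -/
def ContStructure.toPre {L : MetricSignature.{u}} {M : Type u} (𝓜 : ContStructure L M) :
    PreStructure L M where
  nonempty := 𝓜.nonempty
  func := 𝓜.func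
  pred := 𝓜.pred
  dist_self := 𝓜.dist_self
  dist_comm := 𝓜.dist_comm
  dist_triangle := 𝓜.dist_triangle
  func_uc := 𝓜.func_uc
  pred_uc := 𝓜.pred_uc

namespace PreStructure

variable {L : MetricSignature.{u}} {M : Type u} (𝓜 : PreStructure L M)

/-- The interpretation of a term in a prestructure. -/
def termVal {n : ℕ} (a : Fin n → M) : L.toLanguage.Term (Fin n) → M
  | .var i => a i
  | .func f t => 𝓜.func f fun i => termVal a (t i)

/-- The interpretation of a formula in a prestructure. -/
noncomputable def eval : {n : ℕ} → Formula L n → (Fin n → M) → unitInterval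
  | _, .pred P t, a => 𝓜.pred P fun i => 𝓜.termVal a (t i)
  | _, .neg φ, a => negI (eval φ a)
  | _, .half φ, a => halfI (eval φ a)
  | _, .dotminus φ ψ, a => dotminusI (eval φ a) (eval ψ a)
  | _, .sup φ, a => supI fun b : M => eval φ (Fin.snoc (α := fun _ => M) a b)
  | _, .inf φ, a => infI fun b : M => eval φ (Fin.snoc (α := fun _ => M) a b)

/-- The pseudometric given by the distance symbol. -/
abbrev pseudoMetricSpace : PseudoMetricSpace M where
  dist a b := 𝓜.pred L.dist ![a, b]
  dist_self := 𝓜.dist_self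
  dist_comm := 𝓜.dist_comm
  dist_triangle := 𝓜.dist_triangle

theorem uniformContinuous_func {k : ℕ} (f : L.Functions k) :
    letI := 𝓜.pseudoMetricSpace
    UniformContinuous (𝓜.func f) := by
  let := 𝓜.pseudoMetricSpace
  exact uniformContinuous_of_update fun i ε hε =>
    ⟨_, L.funModulus_pos f i ε hε, 𝓜.func_uc f i ε hε⟩

theorem uniformContinuous_pred {k : ℕ} (P : L.Relations k) :
    letI := 𝓜.pseudoMetricSpace
    UniformContinuous (𝓜.pred P) := by
  let := 𝓜.pseudoMetricSpace
  exact uniformContinuous_of_update fun i ε hε =>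
    ⟨_, L.predModulus_pos P i ε hε, 𝓜.pred_uc P i ε hε⟩

theorem uniformContinuous_termVal {n : ℕ} (t : L.toLanguage.Term (Fin n)) :
    letI := 𝓜.pseudoMetricSpace
    UniformContinuous fun a : Fin n → M => 𝓜.termVal a t := by
  let := 𝓜.pseudoMetricSpace
  induction t with
  | var i => exact Pi.uniformContinuous_proj _ i
  | func f t ih => exact (𝓜.uniformContinuous_func f).comp (uniformContinuous_pi.2 ih)

/-- Appending the same `b` to two tuples does not increase their distance, so one modulus works for
all `b` and survives the supremum. -/
theorem uniformContinuous_supI_snoc [PseudoMetricSpace M] {n : ℕ}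
    {F : (Fin (n + 1) → M) → unitInterval} (hF : UniformContinuous F) :
    UniformContinuous fun a : Fin n → M =>
      supI fun b : M => F (Fin.snoc (α := fun _ => M) a b) := by
  rw [Metric.uniformContinuous_iff] at hF ⊢
  intro ε hε
  obtain ⟨δ, hδ, h⟩ := hF (ε / 2) (half_pos hε)
  refine ⟨δ, hδ, fun a a' ha => (dist_supI_le (half_pos hε).le fun b => (h ?_).le).trans_lt
    (half_lt_self hε)⟩
  refine lt_of_le_of_lt ((dist_pi_le_iff dist_nonneg).2 fun i => ?_) ha
  refine Fin.lastCases ?_ (fun j => ?_) i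
  · simp
  · simpa using dist_le_pi_dist a a' j

theorem uniformContinuous_eval {n : ℕ} (φ : Formula L n) :
    letI := 𝓜.pseudoMetricSpace
    UniformContinuous (𝓜.eval φ) := by
  let := 𝓜.pseudoMetricSpace
  induction φ with
  | pred P t =>
    exact (𝓜.uniformContinuous_pred P).comp
      (uniformContinuous_pi.2 fun i => 𝓜.uniformContinuous_termVal (t i))
  | neg φ ih => exact uniformContinuous_negI.comp ih
  | half φ ih => exact uniformContinuous_halfI.comp ih
  | dotminus φ ψ ih₁ ih₂ => exact uniformContinuous_dotminusI.comp (ih₁.prodMk ih₂)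
  | sup φ ih => exact uniformContinuous_supI_snoc ih
  | inf φ ih =>
    exact uniformContinuous_negI.comp (uniformContinuous_supI_snoc (uniformContinuous_negI.comp ih))

end PreStructure

theorem ContStructure.termVal_toPre {L : MetricSignature.{u}} {M : Type u}
    (𝓜 : ContStructure L M) {n : ℕ} (a : Fin n → M) (t : L.toLanguage.Term (Fin n)) :
    𝓜.toPre.termVal a t = 𝓜.termVal a t := by
  induction t with
  | var i => rfl
  | func f t ih => simp only [PreStructure.termVal, ContStructure.termVal, ih]; rfl

theorem ContStructure.eval_toPre {L : MetricSignature.{u}} {M : Type u}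
    (𝓜 : ContStructure L M) {n : ℕ} (φ : Formula L n) (a : Fin n → M) :
    𝓜.toPre.eval φ a = 𝓜.eval φ a := by
  induction φ with
  | pred P t =>
    simp only [PreStructure.eval, ContStructure.eval, ContStructure.termVal_toPre]; rfl
  | neg φ ih => simp only [PreStructure.eval, ContStructure.eval, ih]
  | half φ ih => simp only [PreStructure.eval, ContStructure.eval, ih]
  | dotminus φ ψ ih₁ ih₂ => simp only [PreStructure.eval, ContStructure.eval, ih₁, ih₂]
  | sup φ ih => simp only [PreStructure.eval, ContStructure.eval, ih]
  | inf φ ih => simp only [PreStructure.eval, ContStructure.eval, ih]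

/-! ### Extension of functions of several variables to a completion -/

section Extend

variable {M : Type u} [PseudoMetricSpace M] {k : ℕ}

/-- The canonical map of tuples into tuples of the completion. -/
def toCompl (a : Fin k → M) : Fin k → Completion M := fun i => (a i : Completion M)

theorem isUniformInducing_toCompl : IsUniformInducing (toCompl : (Fin k → M) → _) :=
  (Isometry.piMap (fun _ => ((↑) : M → Completion M))
    fun _ => Completion.coe_isometry).isUniformInducing

theorem denseRange_toCompl : DenseRange (toCompl : (Fin k → M) → _) :=
  DenseRange.piMap fun _ => Completion.denseRange_coe

/-- The continuous extension of a function of several variables to the completion. -/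
noncomputable def extendCompl {Y : Type*} [UniformSpace Y] (F : (Fin k → M) → Y) :
    (Fin k → Completion M) → Y :=
  (isUniformInducing_toCompl.isDenseInducing denseRange_toCompl).extend F

variable {Y : Type*} [UniformSpace Y]

theorem uniformContinuous_extendCompl [CompleteSpace Y] {F : (Fin k → M) → Y} (hF : UniformContinuous F) :
    UniformContinuous (extendCompl F) :=
  uniformContinuous_uniformly_extend isUniformInducing_toCompl denseRange_toCompl hF

theorem extendCompl_toCompl [T0Space Y] {F : (Fin k → M) → Y} (hF : UniformContinuous F) (a : Fin k → M) :
    extendCompl F (toCompl a) = F a :=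
  uniformly_extend_of_ind isUniformInducing_toCompl denseRange_toCompl hF a

theorem toCompl_update (a : Fin k → M) (i : Fin k) (z : M) :
    toCompl (Function.update a i z) = Function.update (toCompl a) i (z : Completion M) := by
  funext j
  by_cases h : j = i
  · subst h; simp [toCompl]
  · simp [toCompl, h]

theorem toCompl_snoc {n : ℕ} (a : Fin n → M) (b : M) :
    toCompl (Fin.snoc (α := fun _ => M) a b) =
      Fin.snoc (α := fun _ => Completion M) (toCompl a) (b : Completion M) := by
  funext i
  refine Fin.lastCases ?_ (fun j => ?_) i <;> simp [toCompl]

theorem toCompl_pair (a b : M) : toCompl ![a, b] = ![(a : Completion M), (b : Completion M)] := by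
  funext i
  fin_cases i <;> rfl

/-- A modulus of continuity in one argument passes to the extension. -/
theorem dist_extendCompl_update_le {Z : Type*} [PseudoMetricSpace Z]
    {G : (Fin k → Completion M) → Z} (hG : Continuous G) (i : Fin k) {δ ε : ℝ}
    (H : ∀ (a : Fin k → M) (z w : M), dist z w < δ →
      dist (G (toCompl (Function.update a i z))) (G (toCompl (Function.update a i w))) ≤ ε)
    (a : Fin k → Completion M) (z w : Completion M) (hzw : dist z w < δ) :
    dist (G (Function.update a i z)) (G (Function.update a i w)) ≤ ε := by
  let e : (Fin k → M) × M × M → (Fin k → Completion M) × Completion M × Completion M :=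
    Prod.map toCompl (Prod.map (↑) (↑))
  have he : DenseRange e := denseRange_toCompl.prodMap
    (Completion.denseRange_coe.prodMap Completion.denseRange_coe)
  -- The hypothesis `dist z w < δ` is open and the conclusion is closed, so it is enough to check
  -- the dense image of tuples from `M`.
  let U : Set ((Fin k → Completion M) × Completion M × Completion M) :=
    {x | dist x.2.1 x.2.2 < δ}
  have hU : IsOpen U := isOpen_lt (by fun_prop) continuous_const
  let C : Set ((Fin k → Completion M) × Completion M × Completion M) :=
    {x | dist (G (Function.update x.1 i x.2.1)) (G (Function.update x.1 i x.2.2)) ≤ ε}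
  have hC : IsClosed C := by
    refine isClosed_le (Continuous.dist ?_ ?_) continuous_const
    · exact hG.comp (continuous_fst.update i (continuous_fst.comp continuous_snd))
    · exact hG.comp (continuous_fst.update i (continuous_snd.comp continuous_snd))
  have hsub : U ∩ range e ⊆ C := by
    rintro _ ⟨h, ⟨b, z', w'⟩, rfl⟩
    have h' : dist z' w' < δ := by rw [← Completion.dist_eq]; exact h
    have := H b z' w' h'
    rw [toCompl_update, toCompl_update] at this
    exact this
  exact closure_minimal hsub hC
    (he.open_subset_closure_inter hU (show (a, z, w) ∈ U from hzw))

end Extend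

namespace PreStructure

variable {L : MetricSignature.{u}} {M : Type u} (𝓜 : PreStructure L M)

/-- The completion of a prestructure. -/
theorem exists_completion : ∃ (N : Type u) (𝓒 : ContStructure L N) (e : M → N),
    ∀ {n : ℕ} (φ : Formula L n) (a : Fin n → M), 𝓒.eval φ (e ∘ a) = 𝓜.eval φ a := by
  let := 𝓜.pseudoMetricSpace
  have huf : ∀ {k : ℕ} (f : L.Functions k),
      UniformContinuous fun a => (𝓜.func f a : Completion M) := fun f =>
    (Completion.uniformContinuous_coe M).comp (𝓜.uniformContinuous_func f)
  have hup : ∀ {k : ℕ} (P : L.Relations k), UniformContinuous (𝓜.pred P) :=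
    𝓜.uniformContinuous_pred
  have hd : ∀ x y : Completion M,
      ((extendCompl (𝓜.pred L.dist) ![x, y] : unitInterval) : ℝ) = dist x y := by
    intro x y
    refine Completion.induction_on₂ x y (isClosed_eq ?_ continuous_dist) fun a b => ?_
    · refine continuous_subtype_val.comp ((uniformContinuous_extendCompl (hup _)).continuous.comp ?_)
      refine continuous_pi fun i => ?_
      fin_cases i
      exacts [continuous_fst, continuous_snd]
    · rw [← toCompl_pair, extendCompl_toCompl (hup _), Completion.dist_eq]
      rfl
  let 𝓒 : ContStructure L (Completion M) :=
    { nonempty := 𝓜.nonempty.map (↑)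
      func := fun f => extendCompl fun a => (𝓜.func f a : Completion M)
      pred := fun P => extendCompl (𝓜.pred P)
      dist_self := fun a => by rw [hd, _root_.dist_self]
      dist_comm := fun a b => by rw [hd, hd, _root_.dist_comm]
      dist_triangle := fun a b c => by simp only [hd]; exact _root_.dist_triangle a b c
      eq_of_dist_eq_zero := fun a b h => by rwa [hd, dist_eq_zero] at h
      func_uc := fun f i ε hε a z w h => by
        rw [hd] at h ⊢
        refine dist_extendCompl_update_le
          (uniformContinuous_extendCompl (huf f)).continuous i ?_ a z w h
        intro a z w h
        rw [extendCompl_toCompl (huf f), extendCompl_toCompl (huf f), Completion.dist_eq]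
        exact 𝓜.func_uc f i ε hε a z w h
      pred_uc := fun P i ε hε a z w h => by
        rw [hd] at h
        refine dist_extendCompl_update_le
          (uniformContinuous_extendCompl (hup P)).continuous i ?_ a z w h
        intro a z w h
        rw [extendCompl_toCompl (hup P), extendCompl_toCompl (hup P)]
        exact 𝓜.pred_uc P i ε hε a z w h
      complete := fun s hs => by
        simp only [hd] at hs ⊢
        obtain ⟨a, ha⟩ := cauchySeq_tendsto_of_complete (Metric.cauchySeq_iff.2 hs)
        exact ⟨a, Metric.tendsto_atTop.1 ha⟩ }
  -- The metric read off from `𝓒` agrees with that of the completion only through `hd`; this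
  -- identification transfers continuity of formulae to the completion topology.
  have hdist : 𝓒.toPre.pseudoMetricSpace.toUniformSpace =
      (inferInstance : UniformSpace (Completion M)) := by
    have : 𝓒.toPre.pseudoMetricSpace =
        (inferInstance : MetricSpace (Completion M)).toPseudoMetricSpace :=
      PseudoMetricSpace.ext (by ext x y; exact hd x y)
    rw [this]; rfl
  have hcont : ∀ {n : ℕ} (φ : Formula L n), Continuous (𝓒.eval φ) := by
    intro n φ
    have := 𝓒.toPre.uniformContinuous_eval φ
    rw [hdist] at this
    refine this.continuous.congr fun a => 𝓒.eval_toPre φ a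
  have hterm : ∀ {n : ℕ} (t : L.toLanguage.Term (Fin n)) (a : Fin n → M),
      𝓒.termVal (toCompl a) t = (𝓜.termVal a t : Completion M) := by
    intro n t a
    induction t with
    | var i => rfl
    | func f t ih =>
      simp only [ContStructure.termVal, termVal, ih]
      exact extendCompl_toCompl (huf f) _
  -- A continuous function has the same supremum over the completion as over the dense image of `M`.
  have hsup : ∀ {n : ℕ} (F : (Fin (n + 1) → Completion M) → unitInterval)
      (G : (Fin (n + 1) → M) → unitInterval), Continuous F → (∀ a, F (toCompl a) = G a) →
      ∀ a : Fin n → M,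
        supI (fun b => F (Fin.snoc (α := fun _ => Completion M) (toCompl a) b)) =
          supI fun b => G (Fin.snoc (α := fun _ => M) a b) := by
    intro n F G hF h a
    refine le_antisymm (supI_le fun x => ?_) (supI_le fun b => ?_)
    · refine Completion.induction_on x (isClosed_le ?_ continuous_const) fun b => ?_
      · exact hF.comp (continuous_const.finSnoc continuous_id)
      · rw [← toCompl_snoc, h]
        exact le_supI (fun b => G (Fin.snoc (α := fun _ => M) a b)) b
    · rw [← h, toCompl_snoc]
      exact le_supI (fun b => F (Fin.snoc (α := fun _ => Completion M) (toCompl a) b)) _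
  refine ⟨Completion M, 𝓒, (↑), fun {n} φ a => ?_⟩
  change 𝓒.eval φ (toCompl a) = _
  induction φ with
  | pred P t =>
    simp only [ContStructure.eval, eval, hterm]
    exact extendCompl_toCompl (hup P) _
  | neg φ ih => simp only [ContStructure.eval, eval, ih]
  | half φ ih => simp only [ContStructure.eval, eval, ih]
  | dotminus φ ψ ih₁ ih₂ => simp only [ContStructure.eval, eval, ih₁, ih₂]
  | sup φ ih => exact hsup _ _ (hcont φ) ih a
  | inf φ ih =>
    exact congrArg negI (hsup (fun a => negI (𝓒.eval φ a)) (fun a => negI (𝓜.eval φ a))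
      (uniformContinuous_negI.continuous.comp (hcont φ)) (fun a => by rw [ih]) a)

end PreStructure

/-! ### Valuations of formulae and separation by formulae -/

/-- An assignment of values to the formulae in `n` variables which respects the connectives. -/
structure IsValuation {L : MetricSignature.{u}} {n : ℕ} (v : Formula L n → unitInterval) :
    Prop where
  neg : ∀ φ, v φ.neg = negI (v φ)
  half : ∀ φ, v φ.half = halfI (v φ)
  dotminus : ∀ φ ψ, v (φ.dotminus ψ) = dotminusI (v φ) (v ψ)

theorem ContStructure.isValuation_eval {L : MetricSignature.{u}} {M : Type u}
    (𝓜 : ContStructure L M) {n : ℕ} (a : Fin n → M) : IsValuation fun φ => 𝓜.eval φ a :=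
  ⟨fun _ => rfl, fun _ => rfl, fun _ _ => rfl⟩

theorem dotminusI_eq_zero {x y : unitInterval} : dotminusI x y = 0 ↔ x ≤ y := by
  rw [← Subtype.coe_inj, ← Subtype.coe_le_coe]
  simp

namespace Formula

variable {L : MetricSignature.{u}} {n : ℕ}

/-- With `n = 0` and no constant symbols there are no terms, so the atomic formula needs a bound
variable. -/
instance : Nonempty (Formula L n) := ⟨.sup (.pred L.dist fun _ => .var (Fin.last n))⟩

/-- The maximum of two formulae. -/
def max (φ ψ : Formula L n) : Formula L n := neg (dotminus (neg φ) (dotminus ψ φ))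

/-- At level `k + 1`, halving reaches the dyadics up to `1 / 2` from those of level `k`, and
negation reflects these onto the upper half. -/
theorem exists_dyadic (k m : ℕ) (hm : m ≤ 2 ^ k) :
    ∃ c : Formula L n, ∀ v, IsValuation v → (v c : ℝ) = m / 2 ^ k := by
  induction k generalizing m with
  | zero =>
    obtain ⟨φ⟩ := (inferInstance : Nonempty (Formula L n))
    have h0 : ∀ v, IsValuation v → (v (φ.dotminus φ) : ℝ) = 0 := fun v hv => by
      rw [hv.dotminus]; simp
    rcases Nat.le_one_iff_eq_zero_or_eq_one.1 (by simpa using hm) with rfl | rfl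
    · exact ⟨_, fun v hv => by rw [h0 v hv]; simp⟩
    · exact ⟨_, fun v hv => by rw [hv.neg, coe_negI, h0 v hv]; simp⟩
  | succ k ih =>
    rcases le_total m (2 ^ k) with h | h
    · obtain ⟨c, hc⟩ := ih m h
      exact ⟨c.half, fun v hv => by rw [hv.half, coe_halfI, hc v hv, pow_succ, div_div]⟩
    · obtain ⟨c, hc⟩ := ih (2 ^ (k + 1) - m) (by rw [pow_succ]; omega)
      refine ⟨c.half.neg, fun v hv => ?_⟩
      rw [hv.neg, hv.half, coe_negI, coe_halfI, hc v hv, Nat.cast_sub hm]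
      field_simp
      push_cast
      ring

theorem exists_const {r s : unitInterval} (h : r < s) :
    ∃ (c : Formula L n) (t : unitInterval), r < t ∧ t < s ∧ ∀ v, IsValuation v → v c = t := by
  have h' : (r : ℝ) < s := h
  obtain ⟨k, hk⟩ := exists_pow_lt_of_lt_one (sub_pos.2 h') (by norm_num : (1 / 2 : ℝ) < 1)
  have h2 : (0 : ℝ) < 2 ^ k := by positivity
  have hr : 0 ≤ (r : ℝ) * 2 ^ k := mul_nonneg r.2.1 h2.le
  -- The least numerator with `m / 2 ^ k` above `r`; as `2 ^ (-k) < s - r`, the fraction remains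
  -- below `s`.
  set m := ⌊(r : ℝ) * 2 ^ k⌋₊ + 1 with hm
  have h3 : (r : ℝ) * 2 ^ k < m := by rw [hm]; exact_mod_cast Nat.lt_floor_add_one _
  have h4 : (m : ℝ) < s * 2 ^ k := by
    have h5 : (m : ℝ) ≤ r * 2 ^ k + 1 := by
      rw [hm]; push_cast; linarith [Nat.floor_le hr]
    rw [one_div, inv_pow, ← one_div, div_lt_iff₀ h2] at hk
    linarith
  have h5 : m ≤ 2 ^ k := by
    have : (m : ℝ) ≤ ((2 ^ k : ℕ) : ℝ) := by
      push_cast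
      exact h4.le.trans (mul_le_of_le_one_left h2.le s.2.2)
    exact_mod_cast this
  obtain ⟨c, hc⟩ := exists_dyadic (L := L) (n := n) k m h5
  have h6 : (r : ℝ) < m / 2 ^ k := (lt_div_iff₀ h2).2 h3
  have h7 : (m / 2 ^ k : ℝ) < s := (div_lt_iff₀ h2).2 h4
  exact ⟨c, ⟨m / 2 ^ k, r.2.1.trans h6.le, h7.le.trans s.2.2⟩, h6, h7,
    fun v hv => Subtype.ext (hc v hv)⟩

end Formula

namespace IsValuation

variable {L : MetricSignature.{u}} {n : ℕ} {v w : Formula L n → unitInterval}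

/-- Makes the zero sets of formulae a directed family, as the compactness argument in
`exists_separating` requires. -/
theorem max_eq_zero (hv : IsValuation v) {φ ψ : Formula L n} :
    v (φ.max ψ) = 0 ↔ v φ = 0 ∧ v ψ = 0 := by
  have h : (v (φ.max ψ) : ℝ) = Max.max (v φ : ℝ) (v ψ) := by
    simp only [Formula.max, hv.neg, hv.dotminus, coe_negI, coe_dotminusI]
    have h1 := (v ψ).2.2
    have h2 := (v φ).2.2
    rcases le_total (v φ : ℝ) (v ψ) with h | h
    · rw [max_eq_left (sub_nonneg.2 h), max_eq_right h, max_eq_left (by linarith)]; ring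
    · rw [max_eq_right (sub_nonpos.2 h), max_eq_left h, max_eq_left (by linarith)]; ring
  have h1 := (v φ).2.1
  have h2 := (v ψ).2.1
  rw [← Subtype.coe_inj, ← Subtype.coe_inj, ← Subtype.coe_inj, h, Set.Icc.coe_zero]
  constructor
  · intro h0
    exact ⟨le_antisymm (h0 ▸ le_max_left _ _) h1, le_antisymm (h0 ▸ le_max_right _ _) h2⟩
  · rintro ⟨h3, h4⟩
    rw [h3, h4, max_self]

/-- A valuation is determined by its zero set. -/
theorem eq_of_zero (hv : IsValuation v) (hw : IsValuation w) (h : ∀ φ, v φ = 0 → w φ = 0) :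
    w = v := by
  have key : ∀ φ, w φ ≤ v φ := by
    intro φ
    by_contra! hlt
    -- For a constant `c` strictly between the two values, `φ ∸ c` vanishes under `v` but not under
    -- `w`.
    obtain ⟨c, t, h1, h2, hc⟩ := Formula.exists_const (L := L) (n := n) hlt
    have := h (φ.dotminus c) (by rw [hv.dotminus, hc v hv, dotminusI_eq_zero]; exact h1.le)
    rw [hw.dotminus, hc w hw, dotminusI_eq_zero] at this
    exact absurd h2 (not_lt.2 this)
  funext φ
  refine le_antisymm (key φ) ?_
  have := negI_le_negI (key φ.neg)
  rwa [hv.neg, hw.neg, negI_negI, negI_negI] at this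

variable {X : Type*} [TopologicalSpace X] [CompactSpace X] {Φ : X → Formula L n → unitInterval}

/-- If a valuation is not among those of a closed set, a formula witnesses this. -/
theorem exists_separating (hv : IsValuation v) (hΦ : ∀ x, IsValuation (Φ x))
    (hc : ∀ φ, Continuous fun x => Φ x φ) {C : Set X} (hC : IsClosed C)
    (hne : ∀ x ∈ C, Φ x ≠ v) :
    ∃ φ, v φ = 0 ∧ ∃ δ : unitInterval, 0 < δ ∧ ∀ x ∈ C, δ ≤ Φ x φ := by
  obtain ⟨ψ⟩ := (inferInstance : Nonempty (Formula L n))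
  have : Nonempty {φ : Formula L n // v φ = 0} :=
    ⟨⟨ψ.dotminus ψ, by rw [hv.dotminus, dotminusI_eq_zero]⟩⟩
  -- By `eq_of_zero`, no point of `C` annihilates every formula in the zero set of `v`; compactness
  -- leaves a single such formula without zeros on `C`, and its minimum there is `δ`.
  obtain ⟨⟨φ, hφ⟩, h⟩ := hC.isCompact.elim_directed_family_closed
    (fun φ : {φ : Formula L n // v φ = 0} => {x | Φ x φ = 0})
    (fun φ => isClosed_eq (hc φ) continuous_const)
    (by
      rw [eq_empty_iff_forall_notMem]
      rintro x ⟨hx, hx'⟩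
      rw [mem_iInter] at hx'
      exact hne x hx (hv.eq_of_zero (hΦ x) fun φ hφ => hx' ⟨φ, hφ⟩))
    (fun φ ψ => ⟨⟨φ.1.max ψ.1, hv.max_eq_zero.2 ⟨φ.2, ψ.2⟩⟩,
      fun x hx => ((hΦ x).max_eq_zero.1 hx).1, fun x hx => ((hΦ x).max_eq_zero.1 hx).2⟩)
  refine ⟨φ, hφ, ?_⟩
  rcases C.eq_empty_or_nonempty with rfl | hCne
  · exact ⟨1, zero_lt_one, by simp⟩
  · obtain ⟨x, hx, hmin⟩ := hC.isCompact.exists_isMinOn hCne (hc φ).continuousOn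
    refine ⟨Φ x φ, lt_of_le_of_ne unitInterval.nonneg' fun h0 => ?_, fun y hy => hmin hy⟩
    exact (eq_empty_iff_forall_notMem.1 h) x ⟨hx, h0.symm⟩

/-- A valuation satisfying all the conditions which hold throughout a compact space of valuations
belongs to that space. -/
theorem exists_eq (hv : IsValuation v) (hΦ : ∀ x, IsValuation (Φ x))
    (hc : ∀ φ, Continuous fun x => Φ x φ) (h : ∀ φ, (∀ x, Φ x φ = 0) → v φ = 0) :
    ∃ x, Φ x = v := by
  by_contra! hne
  obtain ⟨φ, hφ, δ, hδ, hle⟩ := hv.exists_separating hΦ hc isClosed_univ fun x _ => hne x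
  -- With a constant `0 < c < δ`, the formula `c ∸ φ` vanishes at all points but has value `c` under
  -- `v`.
  obtain ⟨c, t, h1, h2, hc⟩ := Formula.exists_const (L := L) (n := n) hδ
  have := h (c.dotminus φ) fun x => by
    rw [(hΦ x).dotminus, hc _ (hΦ x), dotminusI_eq_zero]
    exact h2.le.trans (hle x trivial)
  rw [hv.dotminus, hc _ hv, dotminusI_eq_zero, hφ] at this
  exact absurd h1 (not_lt.2 this)

end IsValuation

/-! ### Ultraproducts and compactness of the type spaces -/

section Ultraproduct

variable {ι : Type u} (U : Ultrafilter ι)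

/-- The limit along an ultrafilter of a family of truth values. -/
noncomputable def ulim (g : ι → unitInterval) : unitInterval := (U.map g).lim

theorem tendsto_ulim (g : ι → unitInterval) : Tendsto g U (𝓝 (ulim U g)) :=
  (U.map g).le_nhds_lim

theorem tendsto_coe_ulim (g : ι → unitInterval) :
    Tendsto (fun i => (g i : ℝ)) U (𝓝 (ulim U g : ℝ)) :=
  (continuous_subtype_val.tendsto _).comp (tendsto_ulim U g)

theorem ulim_map {F : unitInterval → unitInterval} (hF : Continuous F) (g : ι → unitInterval) :
    ulim U (fun i => F (g i)) = F (ulim U g) :=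
  tendsto_nhds_unique (tendsto_ulim U _) ((hF.tendsto _).comp (tendsto_ulim U g))

theorem ulim_mono {g h : ι → unitInterval} (H : ∀ i, g i ≤ h i) : ulim U g ≤ ulim U h :=
  le_of_tendsto_of_tendsto' (tendsto_ulim U g) (tendsto_ulim U h) H

variable {M : ι → Type u}

/-- Near-maximisers chosen in the separate factors form one element of the product; in factors
outside the relevant large set any element will do. -/
theorem supI_ulim (hM : ∀ i, Nonempty (M i)) (G : ∀ i, M i → unitInterval) :
    supI (fun b : ∀ i, M i => ulim U fun i => G i (b i)) = ulim U fun i => supI (G i) := by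
  classical
  refine le_antisymm (supI_le fun b => ulim_mono U fun i => le_supI (G i) (b i)) ?_
  refine le_of_forall_lt_imp_le_of_dense fun c hc => ?_
  have hev := (tendsto_ulim U fun i => supI (G i)).eventually (lt_mem_nhds hc)
  have : ∀ i, ∃ b : M i, c < supI (G i) → c < G i b := fun i => by
    by_cases h : c < supI (G i)
    · obtain ⟨b, hb⟩ := exists_lt_of_lt_supI h
      exact ⟨b, fun _ => hb⟩
    · exact ⟨(hM i).some, fun h' => absurd h' h⟩
  choose b hb using this
  refine le_trans ?_ (le_supI (fun b : ∀ i, M i => ulim U fun i => G i (b i)) b)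
  exact ge_of_tendsto (tendsto_ulim U _) (hev.mono fun i hi => (hb i hi).le)

theorem pair_apply (a b : ∀ i, M i) (i : ι) : (fun j => ![a, b] j i) = ![a i, b i] := by
  funext j
  fin_cases j <;> rfl

theorem update_apply_family {k : ℕ} (a : Fin k → ∀ i, M i) (j : Fin k) (z : ∀ i, M i) (i : ι) :
    (fun l => Function.update a j z l i) = Function.update (fun l => a l i) j (z i) := by
  funext l
  by_cases h : l = j
  · subst h; simp
  · simp [h]

theorem snoc_apply_family {k : ℕ} (a : Fin k → ∀ i, M i) (z : ∀ i, M i) (i : ι) :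
    (fun l => Fin.snoc (α := fun _ => ∀ i, M i) a z l i) =
      Fin.snoc (α := fun _ => M i) (fun l => a l i) (z i) := by
  funext l
  refine Fin.lastCases ?_ (fun j => ?_) l <;> simp

variable {L : MetricSignature.{u}}

/-- The ultraproduct of a family of structures, as a prestructure on the product. -/
noncomputable def ultraproduct (𝓜 : ∀ i, ContStructure L (M i)) : PreStructure L (∀ i, M i) where
  nonempty := ⟨fun i => (𝓜 i).nonempty.some⟩
  func f a i := (𝓜 i).func f fun j => a j i
  pred P a := ulim U fun i => (𝓜 i).pred P fun j => a j i
  dist_self a := by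
    refine tendsto_nhds_unique (tendsto_coe_ulim U _) ?_
    simp only [pair_apply, (𝓜 _).dist_self]
    exact tendsto_const_nhds
  dist_comm a b := by
    simp only [pair_apply]
    congr 2
    funext i
    exact Subtype.ext ((𝓜 i).dist_comm _ _)
  dist_triangle a b c := by
    refine le_of_tendsto_of_tendsto' (tendsto_coe_ulim U _)
      ((tendsto_coe_ulim U _).add (tendsto_coe_ulim U _)) fun i => ?_
    simp only [pair_apply]
    exact (𝓜 i).dist_triangle _ _ _
  func_uc f j ε hε a z w h := by
    have hev := (tendsto_coe_ulim U _).eventually (gt_mem_nhds h)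
    refine le_of_tendsto (tendsto_coe_ulim U _) (hev.mono fun i hi => ?_)
    simp only [pair_apply, update_apply_family] at hi ⊢
    exact (𝓜 i).func_uc f j ε hε _ _ _ hi
  pred_uc P j ε hε a z w h := by
    have hev := (tendsto_coe_ulim U _).eventually (gt_mem_nhds h)
    refine le_of_tendsto ((tendsto_coe_ulim U _).sub (tendsto_coe_ulim U _)).abs
      (hev.mono fun i hi => ?_)
    simp only [pair_apply, update_apply_family] at hi ⊢
    exact (𝓜 i).pred_uc P j ε hε _ _ _ hi

theorem termVal_ultraproduct (𝓜 : ∀ i, ContStructure L (M i)) {n : ℕ}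
    (t : L.toLanguage.Term (Fin n)) (a : Fin n → ∀ i, M i) (i : ι) :
    (ultraproduct U 𝓜).termVal a t i = (𝓜 i).termVal (fun j => a j i) t := by
  induction t with
  | var j => rfl
  | func f t ih => simp only [PreStructure.termVal, ContStructure.termVal, ← ih]; rfl

/-- Łoś's theorem. -/
theorem eval_ultraproduct (𝓜 : ∀ i, ContStructure L (M i)) {n : ℕ} (φ : Formula L n)
    (a : Fin n → ∀ i, M i) :
    (ultraproduct U 𝓜).eval φ a = ulim U fun i => (𝓜 i).eval φ fun j => a j i := by
  induction φ with
  | pred P t =>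
    simp only [PreStructure.eval, ContStructure.eval, ← termVal_ultraproduct U]
    rfl
  | neg φ ih =>
    simp only [PreStructure.eval, ContStructure.eval, ih]
    exact (ulim_map U uniformContinuous_negI.continuous _).symm
  | half φ ih =>
    simp only [PreStructure.eval, ContStructure.eval, ih]
    exact (ulim_map U uniformContinuous_halfI.continuous _).symm
  | dotminus φ ψ ih₁ ih₂ =>
    simp only [PreStructure.eval, ContStructure.eval, ih₁, ih₂]
    exact tendsto_nhds_unique ((uniformContinuous_dotminusI.continuous.tendsto _).comp
      ((tendsto_ulim U _).prodMk_nhds (tendsto_ulim U _))) (tendsto_ulim U _)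
  | sup φ ih =>
    simp only [PreStructure.eval, ContStructure.eval, ih, snoc_apply_family]
    exact supI_ulim U (fun i => (𝓜 i).nonempty)
      fun i b => (𝓜 i).eval φ (Fin.snoc (α := fun _ => M i) (fun j => a j i) b)
  | inf φ ih =>
    simp only [PreStructure.eval, ContStructure.eval, ih, snoc_apply_family, infI,
      ← ulim_map U uniformContinuous_negI.continuous]
    rw [ulim_map U uniformContinuous_negI.continuous]
    exact congrArg negI (supI_ulim U (fun i => (𝓜 i).nonempty)
      fun i b => negI ((𝓜 i).eval φ (Fin.snoc (α := fun _ => M i) (fun j => a j i) b)))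

end Ultraproduct

/-! ### Types realised in models: compactness, openness and amalgamation -/

namespace TypeSpace

variable {L : MetricSignature.{u}} {T : Set (Formula L 0)} {n : ℕ}

/-- The type of a tuple in a model. -/
noncomputable def tp {M : Type u} {𝓜 : ContStructure L M} (h𝓜 : 𝓜.Models T) (a : Fin n → M) :
    TypeSpace T n :=
  ⟨fun φ => 𝓜.eval φ a, M, 𝓜, a, h𝓜, fun _ => rfl⟩

theorem exists_eq_tp (p : TypeSpace T n) :
    ∃ (M : Type u) (𝓜 : ContStructure L M) (h𝓜 : 𝓜.Models T) (a : Fin n → M), p = tp h𝓜 a := by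
  obtain ⟨M, 𝓜, a, h𝓜, h⟩ := p.realised
  exact ⟨M, 𝓜, h𝓜, a, TypeSpace.ext h⟩

theorem map_tp {M : Type u} {𝓜 : ContStructure L M} (h𝓜 : 𝓜.Models T) {m : ℕ} (a : Fin m → M)
    (f : Fin n → Fin m) : map f (tp h𝓜 a) = tp h𝓜 (a ∘ f) :=
  TypeSpace.ext fun φ => 𝓜.eval_relabel φ f a

theorem continuous_val : Continuous (TypeSpace.val : TypeSpace T n → _) := continuous_induced_dom

theorem continuous_val_apply (φ : Formula L n) : Continuous fun p : TypeSpace T n => p.val φ :=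
  (continuous_apply φ).comp continuous_val

theorem val_injective : Function.Injective (TypeSpace.val : TypeSpace T n → _) :=
  fun _ _ h => TypeSpace.ext fun φ => congrFun h φ

instance : T2Space (TypeSpace T n) := T2Space.of_injective_continuous val_injective continuous_val

theorem isValuation_val (p : TypeSpace T n) : IsValuation p.val := by
  obtain ⟨M, 𝓜, h𝓜, a, rfl⟩ := p.exists_eq_tp
  exact 𝓜.isValuation_eval a

/-- The structures are indexed by the type space itself: each type contributes a model and a
realisation, and the ultrafilter converges to the type of the tuple of realisations. -/
instance : CompactSpace (TypeSpace T n) := by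
  refine ⟨isCompact_iff_ultrafilter_le_nhds.2 fun U _ => ?_⟩
  choose M 𝓜 h𝓜 a ha using fun p : TypeSpace T n => p.exists_eq_tp
  obtain ⟨N, 𝓒, e, he⟩ := (ultraproduct U 𝓜).exists_completion
  have hN : 𝓒.Models T := fun φ hφ => by
    rw [Subsingleton.elim (Fin.elim0 : Fin 0 → N) (e ∘ Fin.elim0), he, eval_ultraproduct]
    refine tendsto_nhds_unique (tendsto_ulim U _) (tendsto_const_nhds.congr fun p => ?_)
    rw [Subsingleton.elim (fun j : Fin 0 => (Fin.elim0 j : ∀ p, M p) p) Fin.elim0]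
    exact (h𝓜 p φ hφ).symm
  refine ⟨tp hN (e ∘ fun i p => a p i), trivial, ?_⟩
  rw [nhds_induced]
  refine map_le_iff_le_comap.1 (tendsto_pi_nhds.2 fun φ => ?_)
  have : (tp hN (e ∘ fun i p => a p i)).val φ = ulim U fun p => p.val φ := by
    refine (he φ _).trans ?_
    rw [eval_ultraproduct]
    congr 1
    funext p
    exact (congrArg (fun q : TypeSpace T n => q.val φ) (ha p)).symm
  rw [this]
  exact tendsto_ulim U _

/-- Every open set of types in `n + 1` variables contains, around each of its points, a condition
whose existential quantification is enough to meet the set. -/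
theorem exists_formula_of_isOpen {V : Set (TypeSpace T (n + 1))} (hV : IsOpen V)
    {q : TypeSpace T (n + 1)} (hq : q ∈ V) :
    ∃ ψ : Formula L n, (map Fin.castSucc q).val ψ = 0 ∧ ∃ δ : unitInterval, 0 < δ ∧
      ∀ (M : Type u) (𝓜 : ContStructure L M) (h𝓜 : 𝓜.Models T) (a : Fin n → M),
        𝓜.eval ψ a < δ → ∃ b : M, tp h𝓜 (Fin.snoc (α := fun _ => M) a b) ∈ V := by
  obtain ⟨φ, hφ, δ, hδ, hle⟩ := q.isValuation_val.exists_separating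
    (Φ := fun p : TypeSpace T (n + 1) => p.val) isValuation_val continuous_val_apply
    hV.isClosed_compl fun p hp h => hp (val_injective h ▸ hq)
  refine ⟨.inf φ, ?_, δ, hδ, fun M 𝓜 h𝓜 a h => ?_⟩
  · obtain ⟨M, 𝓜, h𝓜, a, rfl⟩ := q.exists_eq_tp
    rw [map_tp]
    refine le_antisymm ((infI_le _ (a (Fin.last n))).trans ?_) unitInterval.nonneg'
    have : Fin.snoc (α := fun _ => M) (a ∘ Fin.castSucc) (a (Fin.last n)) = a :=
      Fin.snoc_init_self a
    rw [this]
    exact hφ.le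
  · obtain ⟨b, hb⟩ := exists_lt_of_infI_lt h
    refine ⟨b, ?_⟩
    by_contra hn
    exact absurd hb (not_lt.2 (hle _ hn))

/-- The condition `ψ < δ` from `exists_formula_of_isOpen` defines a neighbourhood contained in the
image, since each of its types is realised in some model. -/
theorem isOpenMap_castSucc :
    IsOpenMap (map Fin.castSucc : TypeSpace T (n + 1) → TypeSpace T n) := by
  intro V hV
  rw [isOpen_iff_mem_nhds]
  rintro _ ⟨q, hq, rfl⟩
  obtain ⟨ψ, hψ, δ, hδ, h⟩ := exists_formula_of_isOpen hV hq
  have hopen : IsOpen {p : TypeSpace T n | p.val ψ < δ} :=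
    isOpen_lt (continuous_val_apply ψ) continuous_const
  refine mem_of_superset (hopen.mem_nhds (by rw [mem_ofPred_eq, hψ]; exact hδ)) fun p hp => ?_
  obtain ⟨M, 𝓜, h𝓜, a, rfl⟩ := p.exists_eq_tp
  obtain ⟨b, hb⟩ := h M 𝓜 h𝓜 a hp
  exact ⟨_, hb, by rw [map_tp, Fin.snoc_comp_castSucc]⟩

/-- Every extension of the type of a tuple `a` of a model is approximated by the types of the
extensions of `a` in that model. -/
theorem exists_tp_mem {M : Type u} {𝓜 : ContStructure L M} (h𝓜 : 𝓜.Models T) (a : Fin n → M)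
    (k : ℕ) {V : Set (TypeSpace T (n + k))} (hV : IsOpen V) {q : TypeSpace T (n + k)}
    (hq : q ∈ V) (h : map (Fin.castAdd k) q = tp h𝓜 a) :
    ∃ c : Fin (n + k) → M, c ∘ Fin.castAdd k = a ∧ tp h𝓜 c ∈ V := by
  induction k with
  | zero =>
    obtain ⟨N, 𝓒, h𝓒, b, rfl⟩ := q.exists_eq_tp
    refine ⟨a, rfl, ?_⟩
    rw [map_tp] at h
    exact h ▸ hq
  | succ k ih =>
    -- Openness of restriction lets the first `k` new coordinates be found for the image of `V`; the
    -- last one then comes from `exists_formula_of_isOpen`.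
    obtain ⟨c, hc, q', hq', hqc⟩ := ih (isOpenMap_castSucc _ hV)
      (mem_image_of_mem (map Fin.castSucc) hq) (by
        rw [← h]
        exact ((typeFunctor T).map_comp (Fin.castAdd k) Fin.castSucc q).symm)
    obtain ⟨ψ, hψ, δ, hδ, H⟩ := exists_formula_of_isOpen hV hq'
    obtain ⟨b, hb⟩ := H M 𝓜 h𝓜 c (by
      rw [hqc] at hψ
      exact (show 𝓜.eval ψ c = 0 from hψ).trans_lt hδ)
    refine ⟨_, ?_, hb⟩
    rw [← hc]
    funext i
    exact Fin.snoc_castSucc (α := fun _ => M) b c (Fin.castAdd k i)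

theorem isDiagonal_tp {M : Type u} {𝓜 : ContStructure L M} (h𝓜 : 𝓜.Models T) (a : Fin 2 → M) :
    (typeFunctor T).IsDiagonal (tp h𝓜 a) ↔ a 0 = a 1 := by
  constructor
  · rintro ⟨p, hp⟩
    obtain ⟨N, 𝓒, h𝓒, b, rfl⟩ := TypeSpace.exists_eq_tp p
    have h1 : map (fun _ : Fin 2 => (0 : Fin 1)) (tp h𝓒 b) = tp h𝓜 a := hp
    rw [map_tp] at h1
    have h2 := congrArg (fun q : TypeSpace T 2 => (q.val (.pred L.dist ![.var 0, .var 1]) : ℝ)) h1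
    have h3 : ∀ {N : Type u} {𝓒 : ContStructure L N} (b : Fin 2 → N),
        𝓒.eval (.pred L.dist ![.var 0, .var 1]) b = 𝓒.pred L.dist ![b 0, b 1] := by
      intro N 𝓒 b
      simp only [ContStructure.eval]
      congr 1
      funext i
      fin_cases i <;> rfl
    simp only [tp, h3] at h2
    exact 𝓜.eq_of_dist_eq_zero _ _ (h2.symm.trans (𝓒.dist_self _))
  · intro h
    refine ⟨tp h𝓜 fun _ : Fin 1 => a 0, ?_⟩
    refine (map_tp h𝓜 _ _).trans (congrArg _ ?_)
    funext i
    fin_cases i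
    exacts [rfl, h]

/-- The types of tuples in one model extending the realisation `a` of `p` approximate `q` over `a ∘
f`. Their closure is compact, so a limit point achieves `q` exactly. -/
theorem amalgamation {m k : ℕ} (f : Fin n → Fin m) (g : Fin n → Fin k)
    (p : TypeSpace T m) (q : TypeSpace T k) (h : map f p = map g q) :
    ∃ r : TypeSpace T (m + k), map (Fin.castAdd k) r = p ∧ map (Fin.natAdd m) r = q ∧
      ∀ i : Fin n, (typeFunctor T).IsDiagonal
        (map ![Fin.castAdd k (f i), Fin.natAdd m (g i)] r) := by
  have hmap : ∀ {m n : ℕ} (f : Fin n → Fin m), Continuous (map f : TypeSpace T m → TypeSpace T n) :=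
    (typeFunctor T).map_continuous
  have hcomp : ∀ {n m k : ℕ} (f : Fin n → Fin m) (g : Fin m → Fin k) (p : TypeSpace T k),
    map f (map g p) = map (g ∘ f) p := fun f g p => ((typeFunctor T).map_comp f g p).symm
  obtain ⟨M, 𝓜, h𝓜, a, rfl⟩ := p.exists_eq_tp
  let A : Set (TypeSpace T (m + k)) := {r | ∃ c : Fin (m + k) → M, c ∘ Fin.castAdd k = a ∧
    r = tp h𝓜 c}
  -- `q'` is `q` preceded by a copy of its subtuple `g`. In the amalgam, `e` puts the subtuple `f`
  -- of the first part in that place, so restricting along `e` to `q'` encodes both `q` and the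
  -- required equalities.
  let e : Fin (n + k) → Fin (m + k) := Fin.append (Fin.castAdd k ∘ f) (Fin.natAdd m)
  let q' : TypeSpace T (n + k) := map (Fin.append g id) q
  have he1 : e ∘ Fin.castAdd k = Fin.castAdd k ∘ f := by
    funext i; simp only [e, Function.comp_apply, Fin.append_left]
  have he2 : e ∘ Fin.natAdd n = Fin.natAdd m := by
    funext i; simp only [e, Function.comp_apply, Fin.append_right]
  have hg1 : Fin.append g id ∘ Fin.castAdd k = g := by
    funext i; simp only [Function.comp_apply, Fin.append_left]
  have hg2 : Fin.append g id ∘ Fin.natAdd n = id := by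
    funext i; simp only [Function.comp_apply, Fin.append_right]
  have hq' : q' ∈ closure (map e '' A) := by
    rw [mem_closure_iff]
    intro V hV hqV
    obtain ⟨c, hc, hcV⟩ := exists_tp_mem h𝓜 (a ∘ f) k hV hqV (by
      rw [hcomp, hg1, ← h, map_tp])
    refine ⟨_, hcV, tp h𝓜 (Fin.append a (c ∘ Fin.natAdd n)), ⟨_, ?_, rfl⟩, ?_⟩
    · funext i; simp only [Function.comp_apply, Fin.append_left]
    · rw [map_tp]
      congr 1
      funext i
      refine Fin.addCases (fun j => ?_) (fun j => ?_) i
      · have := congrFun hc j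
        simp only [e, Function.comp_apply, Fin.append_left] at this ⊢
        exact this.symm
      · simp only [e, Function.comp_apply, Fin.append_right]
  have himg : IsClosed (map e '' closure A) :=
    (isClosed_closure.isCompact.image (hmap e)).isClosed
  obtain ⟨r, hr, hrq⟩ := closure_minimal (image_mono subset_closure) himg hq'
  refine ⟨r, ?_, ?_, fun i => ?_⟩
  · refine closure_minimal (t := {r | map (Fin.castAdd k) r = tp h𝓜 a}) ?_
      (isClosed_eq (hmap _) continuous_const) hr
    rintro _ ⟨c, hc, rfl⟩
    rw [mem_ofPred_eq, map_tp, hc]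
  · rw [← he2, ← hcomp, hrq, hcomp, hg2]
    exact (typeFunctor T).map_id q
  · have h1 : ![Fin.castAdd k (f i), Fin.natAdd m (g i)] =
        e ∘ ![Fin.castAdd k i, Fin.natAdd n (g i)] := by
      funext j
      fin_cases j
      · exact (congrFun he1 i).symm
      · exact (congrFun he2 (g i)).symm
    rw [h1, ← hcomp, hrq, hcomp]
    obtain ⟨N, 𝓒, h𝓒, b, rfl⟩ := q.exists_eq_tp
    rw [map_tp, isDiagonal_tp]
    exact congrArg b ((congrFun hg1 i).trans (congrFun hg2 (g i)).symm)

end TypeSpace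

theorem isOpenHausdorffCat_typeFunctor {L : MetricSignature.{u}} (T : Set (Formula L 0)) :
    (typeFunctor T).IsOpenHausdorffCat where
  compact n := (inferInstance : CompactSpace (TypeSpace T n))
  hausdorff n := (inferInstance : T2Space (TypeSpace T n))
  isOpenMap n := TypeSpace.isOpenMap_castSucc
  surjective p := by
    obtain ⟨M, 𝓜, h𝓜, a, rfl⟩ := TypeSpace.exists_eq_tp p
    obtain ⟨b⟩ := 𝓜.nonempty
    exact ⟨TypeSpace.tp h𝓜 fun _ => b,
      (TypeSpace.map_tp h𝓜 _ _).trans (congrArg _ (Subsingleton.elim _ _))⟩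
  equality p i j h := by
    obtain ⟨M, 𝓜, h𝓜, a, rfl⟩ := TypeSpace.exists_eq_tp p
    have h1 : (typeFunctor T).IsDiagonal (TypeSpace.map ![i, j] (TypeSpace.tp h𝓜 a)) := h
    rw [TypeSpace.map_tp, TypeSpace.isDiagonal_tp] at h1
    refine (TypeSpace.map_tp h𝓜 _ _).trans (congrArg _ ?_)
    funext l
    by_cases hl : l = j
    · subst hl; simpa using h1
    · simp [hl]
  amalgamation := TypeSpace.amalgamation

theorem typeDist_tp {L : MetricSignature.{u}} {T : Set (Formula L 0)} {M : Type u}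
    {𝓜 : ContStructure L M} (h𝓜 : 𝓜.Models T) (a : Fin 2 → M) :
    typeDist T (TypeSpace.tp h𝓜 a) = 𝓜.pred L.dist ![a 0, a 1] := by
  change 𝓜.pred L.dist (fun i => a i) = _
  congr 1
  funext i
  fin_cases i <;> rfl

theorem isDefinableMetric_typeDist {L : MetricSignature.{u}} (T : Set (Formula L 0)) :
    (typeFunctor T).IsDefinableMetric (typeDist T) where
  continuous := TypeSpace.continuous_val_apply _
  eq_zero_iff p := by
    obtain ⟨M, 𝓜, h𝓜, a, rfl⟩ := TypeSpace.exists_eq_tp p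
    rw [typeDist_tp, TypeSpace.isDiagonal_tp, ← Subtype.coe_inj]
    refine ⟨𝓜.eq_of_dist_eq_zero _ _, fun h => ?_⟩
    rw [h]
    exact 𝓜.dist_self _
  symm p := by
    obtain ⟨M, 𝓜, h𝓜, a, rfl⟩ := TypeSpace.exists_eq_tp p
    refine (congrArg (typeDist T) (TypeSpace.map_tp h𝓜 a ![1, 0])).trans ?_
    rw [typeDist_tp, typeDist_tp]
    exact Subtype.ext (𝓜.dist_comm _ _)
  triangle p := by
    obtain ⟨M, 𝓜, h𝓜, a, rfl⟩ := TypeSpace.exists_eq_tp p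
    have h : ∀ i j : Fin 3, typeDist T ((typeFunctor T).map ![i, j] (TypeSpace.tp h𝓜 a)) =
        𝓜.pred L.dist ![a i, a j] := fun i j =>
      (congrArg (typeDist T) (TypeSpace.map_tp h𝓜 a ![i, j])).trans (typeDist_tp h𝓜 _)
    rw [h, h, h]
    exact 𝓜.dist_triangle _ _ _

/-! ### Open Hausdorff cats -/

theorem liftVar_comp_castSucc {n m : ℕ} (f : Fin n → Fin m) :
    liftVar f ∘ Fin.castSucc = Fin.castSucc ∘ f :=
  Fin.snoc_comp_castSucc

/-- A compact Hausdorff space with a basis of cardinality at most `κ` has a separating family of at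
most `κ` continuous functions. -/
theorem exists_separating_functions {X : Type u} [TopologicalSpace X]
    [CompactSpace X] [T2Space X] {κ : Cardinal.{u}} (hκ : ℵ₀ ≤ κ) {B : Set (Set X)}
    (hB : TopologicalSpace.IsTopologicalBasis B) (hBκ : #B ≤ κ) :
    ∃ A : Set (X → unitInterval), #A ≤ κ ∧ (∀ F ∈ A, Continuous F) ∧
      ∀ p q : X, (∀ F ∈ A, F p = F q) → p = q := by
  -- One Urysohn function per pair of basic sets with disjoint closures, and the zero function for
  -- the other pairs; at most `κ * κ = κ` functions in all.
  have hU : ∀ z : B × B, ∃ F : X → unitInterval, Continuous F ∧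
      (Disjoint (closure z.1.1) (closure z.2.1) →
        (∀ x ∈ z.1.1, F x = 0) ∧ ∀ x ∈ z.2.1, F x = 1) := by
    rintro ⟨U, V⟩
    by_cases h : Disjoint (closure U.1) (closure V.1)
    · obtain ⟨f, h0, h1, h01⟩ :=
        exists_continuous_zero_one_of_isClosed isClosed_closure isClosed_closure h
      exact ⟨fun x => ⟨f x, h01 x⟩, f.continuous.subtype_mk _, fun _ =>
        ⟨fun x hx => Subtype.ext (h0 (subset_closure hx)),
          fun x hx => Subtype.ext (h1 (subset_closure hx))⟩⟩
    · exact ⟨fun _ => 0, continuous_const, fun h' => absurd h' h⟩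
  choose F hF hFz using hU
  refine ⟨range F, ?_, ?_, fun p q h => ?_⟩
  · refine mk_range_le.trans ?_
    rw [mk_prod, lift_id]
    exact (mul_le_mul' hBκ hBκ).trans_eq (mul_eq_self hκ)
  · rintro _ ⟨z, rfl⟩
    exact hF z
  · by_contra hne
    obtain ⟨U, hpU, hU, V, hqV, hV, hUV⟩ := exists_open_nhds_disjoint_closure hne
    obtain ⟨U', hU', hpU', hsU⟩ := hB.exists_subset_of_mem_open hpU hU
    obtain ⟨V', hV', hqV', hsV⟩ := hB.exists_subset_of_mem_open hqV hV
    obtain ⟨h0, h1⟩ := hFz (⟨U', hU'⟩, ⟨V', hV'⟩)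
      (hUV.mono (closure_mono hsU) (closure_mono hsV))
    have := h _ ⟨(⟨U', hU'⟩, ⟨V', hV'⟩), rfl⟩
    rw [h0 p hpU', h1 q hqV'] at this
    exact zero_ne_one this

namespace TypeFunctor

variable {S : TypeFunctor.{u}}

theorem isDiagonal_refl {N : ℕ} (r : S.space N) (c : Fin N) : S.IsDiagonal (S.map ![c, c] r) := by
  refine ⟨S.map (fun _ => c) r, ?_⟩
  rw [← S.map_comp]
  congr 1
  funext i
  fin_cases i <;> rfl

namespace IsOpenHausdorffCat

/-- Subtuples which are coordinatewise equal according to a type have the same type. -/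
theorem map_eq_map (hS : S.IsOpenHausdorffCat) {n N : ℕ} (r : S.space N) (f g : Fin n → Fin N)
    (h : ∀ i, S.IsDiagonal (S.map ![f i, g i] r)) : S.map f r = S.map g r := by
  have key : ∀ s : Finset (Fin n), S.map (s.piecewise f g) r = S.map g r := by
    intro s
    induction s using Finset.induction_on with
    | empty => simp
    | insert i s hi ih =>
      rw [← ih, Finset.piecewise_insert]
      set w := s.piecewise f g with hw
      have hwi : w i = g i := by simp [hw, hi]
      -- An additional last variable carries `f i`, so that the equality axiom replaces the `i`-th
      -- entry of `w` and no other.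
      let e : Fin (n + 1) → Fin N := Fin.snoc (α := fun _ => Fin N) w (f i)
      have h1 : e ∘ ![Fin.last n, i.castSucc] = ![f i, g i] := by
        funext j
        fin_cases j <;> simp [e, hwi]
      have h2 := hS.equality (S.map e r) (Fin.last n) i.castSucc (by
        rw [← S.map_comp, h1]
        exact h i)
      have h3 := congrArg (S.map Fin.castSucc) h2
      rw [← S.map_comp, ← S.map_comp, ← S.map_comp] at h3
      convert h3 using 2
      · funext j
        by_cases hj : j = i
        · subst hj; simp [e]
        · have : j.castSucc ≠ i.castSucc := fun h => hj (Fin.castSucc_injective n h)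
          simp [e, hj]
      · exact (Fin.snoc_comp_castSucc (α := Fin N)).symm
  simpa using key Finset.univ

/-- Amalgamating `s` and `q` over the shared `k` variables duplicates these; only the last variable
of `q` is kept, and `map_eq_map` exchanges the duplicates for the originals. -/
theorem exists_lift (hS : S.IsOpenHausdorffCat) {k N : ℕ} (f : Fin k → Fin N) (s : S.space N)
    (q : S.space (k + 1)) (h : S.map Fin.castSucc q = S.map f s) :
    ∃ s' : S.space (N + 1), S.map Fin.castSucc s' = s ∧ S.map (liftVar f) s' = q := by
  obtain ⟨r, h1, h2, h3⟩ := hS.amalgamation f Fin.castSucc s q h.symm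
  let e : Fin (N + 1) → Fin (N + (k + 1)) :=
    Fin.snoc (α := fun _ => Fin (N + (k + 1))) (Fin.castAdd (k + 1))
      (Fin.natAdd N (Fin.last k))
  refine ⟨S.map e r, ?_, ?_⟩
  · rw [← S.map_comp]
    exact (congrArg (fun g => S.map g r) (Fin.snoc_comp_castSucc (α := Fin (N + (k + 1))))).trans h1
  · rw [← S.map_comp, ← h2]
    refine hS.map_eq_map r _ _ fun i => ?_
    refine Fin.lastCases ?_ (fun j => ?_) i
    · simp only [e, liftVar, Function.comp_apply, Fin.snoc_last]
      exact isDiagonal_refl r _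
    · simp only [e, liftVar, Function.comp_apply, Fin.snoc_castSucc]
      exact h3 j

/-- Amalgamation with a `1`-type over the common `0`-type; fibres of restriction are thus nonempty.
-/
theorem exists_extend (hS : S.IsOpenHausdorffCat) {n : ℕ} (p : S.space n) :
    ∃ q : S.space (n + 1), S.map Fin.castSucc q = p := by
  obtain ⟨q, hq⟩ := hS.surjective (S.map Fin.elim0 p)
  obtain ⟨r, hr, -⟩ := hS.exists_lift Fin.elim0 p q
    ((congrArg (fun g => S.map g q) (Subsingleton.elim _ _)).trans hq)
  exact ⟨r, hr⟩

end IsOpenHausdorffCat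

/-- The supremum of a function over the extensions of a type by one variable. -/
noncomputable def fiberSup (S : TypeFunctor.{u}) {n : ℕ} (F : S.space (n + 1) → unitInterval)
    (p : S.space n) : unitInterval :=
  supI fun q : {q : S.space (n + 1) // S.map Fin.castSucc q = p} => F q.1

theorem le_fiberSup {n : ℕ} (F : S.space (n + 1) → unitInterval) (q : S.space (n + 1)) :
    F q ≤ S.fiberSup F (S.map Fin.castSucc q) :=
  le_supI (fun q' : {q' // S.map Fin.castSucc q' = S.map Fin.castSucc q} => F q'.1) ⟨q, rfl⟩

theorem fiberSup_le {n : ℕ} {F : S.space (n + 1) → unitInterval} {p : S.space n}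
    {c : unitInterval} (h : ∀ q, S.map Fin.castSucc q = p → F q ≤ c) : S.fiberSup F p ≤ c :=
  supI_le fun q => h q.1 q.2

theorem IsOpenHausdorffCat.exists_eq_fiberSup (hS : S.IsOpenHausdorffCat) {n : ℕ}
    {F : S.space (n + 1) → unitInterval} (hF : Continuous F) (p : S.space n) :
    ∃ q, S.map Fin.castSucc q = p ∧ F q = S.fiberSup F p := by
  have := hS.compact (n + 1)
  have := hS.hausdorff n
  have hc : IsCompact {q | S.map Fin.castSucc q = p} :=
    (isClosed_eq (S.map_continuous _) continuous_const).isCompact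
  obtain ⟨q, hq, hmax⟩ := hc.exists_isMaxOn (hS.exists_extend p) hF.continuousOn
  have hq' : S.map Fin.castSucc q = p := hq
  refine ⟨q, hq, le_antisymm ?_ (fiberSup_le fun q' h => hmax h)⟩
  have := le_fiberSup F q
  rwa [hq'] at this

/-- As the supremum is attained, `{c < sup}` is the image of an open set under an open map, and `{c
≤ sup}` is the image of a compact set, hence closed. -/
theorem IsOpenHausdorffCat.continuous_fiberSup (hS : S.IsOpenHausdorffCat) {n : ℕ}
    {F : S.space (n + 1) → unitInterval} (hF : Continuous F) : Continuous (S.fiberSup F) := by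
  have := hS.compact (n + 1)
  have := hS.hausdorff n
  rw [OrderTopology.continuous_iff]
  refine fun c => ⟨?_, ?_⟩
  · convert hS.isOpenMap n _ (isOpen_lt (continuous_const (y := c)) hF) using 1
    ext p
    constructor
    · intro hp
      obtain ⟨q, hq, hFq⟩ := hS.exists_eq_fiberSup hF p
      exact ⟨q, lt_of_lt_of_eq hp hFq.symm, hq⟩
    · rintro ⟨q, hq, rfl⟩
      exact lt_of_lt_of_le hq (le_fiberSup F q)
  · rw [← isClosed_compl_iff]
    convert ((isClosed_le (continuous_const (y := c)) hF).isCompact.image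
      (S.map_continuous Fin.castSucc)).isClosed using 1
    ext p
    constructor
    · intro hp
      obtain ⟨q, hq, hFq⟩ := hS.exists_eq_fiberSup hF p
      exact ⟨q, (not_lt.1 (show ¬ S.fiberSup F p < c from hp)).trans_eq hFq.symm, hq⟩
    · rintro ⟨q, hq, rfl⟩
      exact not_lt.2 (le_trans hq (le_fiberSup F q))

/-- Quantification commutes with substitution: `exists_lift` lifts any extension of `f^* p` to one
of `p`. -/
theorem IsOpenHausdorffCat.fiberSup_map (hS : S.IsOpenHausdorffCat) {n m : ℕ} (f : Fin n → Fin m)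
    (F : S.space (n + 1) → unitInterval) (p : S.space m) :
    S.fiberSup (fun q => F (S.map (liftVar f) q)) p = S.fiberSup F (S.map f p) := by
  refine le_antisymm (fiberSup_le fun q hq => ?_) (fiberSup_le fun q hq => ?_)
  · have h := le_fiberSup F (S.map (liftVar f) q)
    rwa [← S.map_comp, liftVar_comp_castSucc, S.map_comp, hq] at h
  · obtain ⟨s, rfl, rfl⟩ := hS.exists_lift f p q hq
    exact le_fiberSup (fun q => F (S.map (liftVar f) q)) s

/-- Continuous functions on the type spaces are uniformly continuous in each variable with respect
to a definable metric. -/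
theorem IsOpenHausdorffCat.exists_modulus (hS : S.IsOpenHausdorffCat)
    {d : S.space 2 → unitInterval} (hd : S.IsDefinableMetric d) {k : ℕ}
    {F : S.space k → unitInterval} (hF : Continuous F) (i : Fin k) (ε : ℝ) (hε : 0 < ε) :
    ∃ δ : ℝ, 0 < δ ∧ ∀ r : S.space (k + 1), (d (S.map ![i.castSucc, Fin.last k] r) : ℝ) < δ →
      |(F (S.map Fin.castSucc r) : ℝ) -
        F (S.map (Function.update Fin.castSucc i (Fin.last k)) r)| ≤ ε := by
  have := hS.compact (k + 1)
  let g : S.space (k + 1) → ℝ := fun r => |(F (S.map Fin.castSucc r) : ℝ) -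
        F (S.map (Function.update Fin.castSucc i (Fin.last k)) r)|
  have hg : Continuous g := by
    have h : ∀ f : Fin k → Fin (k + 1), Continuous fun r => (F (S.map f r) : ℝ) := fun f =>
      continuous_subtype_val.comp (hF.comp (S.map_continuous f))
    exact ((h _).sub (h _)).abs
  let D : S.space (k + 1) → unitInterval := fun r => d (S.map ![i.castSucc, Fin.last k] r)
  have hD : Continuous D := hd.continuous.comp (S.map_continuous _)
  have hC : IsCompact {r | ε ≤ g r} := (isClosed_le continuous_const hg).isCompact
  rcases {r | ε ≤ g r}.eq_empty_or_nonempty with he | hne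
  · refine ⟨1, one_pos, fun r _ => le_of_lt ?_⟩
    by_contra hr
    exact (eq_empty_iff_forall_notMem.1 he) r (not_lt.1 hr)
  · obtain ⟨r₀, hr₀, hmin⟩ := hC.exists_isMinOn hne hD.continuousOn
    refine ⟨D r₀, lt_of_le_of_ne (D r₀).2.1 fun h0 => ?_, fun r hr => le_of_lt ?_⟩
    · have hdiag := (hd.eq_zero_iff _).1 (Subtype.ext h0.symm : D r₀ = 0)
      have heq := hS.map_eq_map r₀ Fin.castSucc (Function.update Fin.castSucc i (Fin.last k))
        fun j => by
          by_cases hj : j = i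
          · subst hj; simpa using hdiag
          · rw [Function.update_of_ne hj]; exact isDiagonal_refl _ _
      have h1 : ε ≤ g r₀ := hr₀
      simp only [g, heq, sub_self, abs_zero] at h1
      exact absurd hε (not_lt.2 h1)
    · by_contra h
      exact absurd hr (not_lt.2 (hmin (not_lt.1 h)))

/-! ### The theory of a metric open Hausdorff cat -/

/-- A family of continuous predicates which separates types and contains a definable metric,
together with moduli of uniform continuity. -/
structure PredicateSystem (S : TypeFunctor.{u}) where
  isCat : S.IsOpenHausdorffCat
  dist : S.space 2 → unitInterval
  isMetric : S.IsDefinableMetric dist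
  preds : ∀ n, Set (S.space n → unitInterval)
  dist_mem : dist ∈ preds 2
  continuous : ∀ {n}, ∀ F ∈ preds n, Continuous F
  separates : ∀ {n} (p q : S.space n), (∀ F ∈ preds n, F p = F q) → p = q
  modulus : ∀ {k : ℕ}, preds k → Fin k → ℝ → ℝ
  modulus_pos : ∀ {k : ℕ} (F : preds k) (i : Fin k) (ε : ℝ), 0 < ε → 0 < modulus F i ε
  modulus_spec : ∀ {k : ℕ} (F : preds k) (i : Fin k) (ε : ℝ), 0 < ε → ∀ r : S.space (k + 1),
    (dist (S.map ![i.castSucc, Fin.last k] r) : ℝ) < modulus F i ε →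
      |(F.1 (S.map Fin.castSucc r) : ℝ) -
        F.1 (S.map (Function.update Fin.castSucc i (Fin.last k)) r)| ≤ ε

namespace PredicateSystem

variable (D : PredicateSystem S)

/-- The relational signature with a symbol for each predicate of the system. -/
def signature : MetricSignature.{u} where
  Functions _ := PEmpty
  Relations n := D.preds n
  dist := ⟨D.dist, D.dist_mem⟩
  funModulus f := f.elim
  funModulus_pos f := f.elim
  predModulus := D.modulus
  predModulus_pos := D.modulus_pos

/-- In a relational signature every term is a variable. -/
def termVar {n : ℕ} : D.signature.toLanguage.Term (Fin n) → Fin n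
  | .var i => i
  | .func f _ => PEmpty.elim f

/-- The continuous function on the type space given by a formula. -/
noncomputable def interp : {n : ℕ} → Formula D.signature n → S.space n → unitInterval
  | _, .pred P t, p => P.1 (S.map (fun i => D.termVar (t i)) p)
  | _, .neg φ, p => negI (interp φ p)
  | _, .half φ, p => halfI (interp φ p)
  | _, .dotminus φ ψ, p => dotminusI (interp φ p) (interp ψ p)
  | _, .sup φ, p => S.fiberSup (interp φ) p
  | _, .inf φ, p => negI (S.fiberSup (fun q => negI (interp φ q)) p)

theorem isValuation_interp {n : ℕ} (p : S.space n) : IsValuation fun φ => D.interp φ p :=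
  ⟨fun _ => rfl, fun _ => rfl, fun _ _ => rfl⟩

theorem continuous_interp {n : ℕ} (φ : Formula D.signature n) : Continuous (D.interp φ) := by
  have hneg := uniformContinuous_negI.continuous
  induction φ with
  | pred P t => exact (D.continuous P.1 P.2).comp (S.map_continuous _)
  | neg φ ih => exact hneg.comp ih
  | half φ ih => exact uniformContinuous_halfI.continuous.comp ih
  | dotminus φ ψ ih₁ ih₂ =>
    exact uniformContinuous_dotminusI.continuous.comp (ih₁.prodMk ih₂)
  | sup φ ih => exact D.isCat.continuous_fiberSup ih
  | inf φ ih => exact hneg.comp (D.isCat.continuous_fiberSup (hneg.comp ih))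

theorem termVar_relabel {n m : ℕ} (f : Fin n → Fin m) (t : D.signature.toLanguage.Term (Fin n)) :
    D.termVar (t.relabel f) = f (D.termVar t) := by
  cases t with
  | var i => rfl
  | func g _ => exact PEmpty.elim g

theorem interp_relabel {n : ℕ} (φ : Formula D.signature n) : ∀ {m : ℕ} (f : Fin n → Fin m)
    (p : S.space m), D.interp (φ.relabel f) p = D.interp φ (S.map f p) := by
  induction φ with
  | pred P t =>
    intro m f p
    simp only [Formula.relabel, interp, termVar_relabel, ← S.map_comp]
    rfl
  | neg φ ih => intro m f p; simp only [Formula.relabel, interp, ih]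
  | half φ ih => intro m f p; simp only [Formula.relabel, interp, ih]
  | dotminus φ ψ ih₁ ih₂ => intro m f p; simp only [Formula.relabel, interp, ih₁, ih₂]
  | sup φ ih =>
    intro m f p
    simp only [Formula.relabel, interp, ← D.isCat.fiberSup_map, ← ih]
  | inf φ ih =>
    intro m f p
    simp only [Formula.relabel, interp, ← D.isCat.fiberSup_map, ← ih]

/-- The theory of all sentences which vanish identically on `S_0`. -/
def theory : Set (Formula D.signature 0) := {φ | ∀ p, D.interp φ p = 0}

end PredicateSystem

/-! ### Realising types in models -/

/-- Constants together with formal witnesses for the suprema of functions on the type spaces. -/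
inductive Witness (S : TypeFunctor.{u}) (n : ℕ) : Type u
  | const (i : Fin n) : Witness S n
  | wit (k : ℕ) (F : S.space (k + 1) → unitInterval) (a : Fin k → Witness S n) : Witness S n

namespace Witness

variable {n : ℕ}

/-- The depth of a formal witness. -/
def rank : Witness S n → ℕ
  | const _ => 0
  | wit _ _ a => (Finset.univ.sup fun i => (a i).rank) + 1

theorem rank_lt {k : ℕ} (F : S.space (k + 1) → unitInterval) (a : Fin k → Witness S n)
    (i : Fin k) : (a i).rank < (wit k F a).rank :=
  Nat.lt_succ_of_le (Finset.le_sup (f := fun i => (a i).rank) (Finset.mem_univ i))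

/-- A family of types of tuples treats `x` correctly if `x` is indeed a witness according to it. -/
def IsCorrect (P : ∀ m, (Fin m → Witness S n) → S.space m) (x : Witness S n) : Prop :=
  ∀ k F a, x = wit k F a → Continuous F →
    F (P (k + 1) (Fin.snoc (α := fun _ => Witness S n) a x)) = S.fiberSup F (P k a)

/-- Witnesses are added in order of increasing rank. The new `x` is then not an argument of itself
or of any earlier witness, so redirecting `e` at `x` to a fresh variable preserves all that was
arranged before. -/
theorem exists_finite_stage (hS : S.IsOpenHausdorffCat) (p : S.space (n + 1))
    (u : Finset (Witness S (n + 1))) :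
    ∃ (N : ℕ) (s : S.space N) (e : Witness S (n + 1) → Fin N), S.map (e ∘ const) s = p ∧
      ∀ x ∈ u, IsCorrect (fun _ a => S.map (e ∘ a) s) x := by
  classical
  refine Finset.induction_on_max_value rank u ?_ fun x u hx hmax ih => ?_
  · refine ⟨n + 1, p, fun x => match x with | const i => i | wit _ _ _ => 0, ?_, by simp⟩
    exact S.map_id p
  · obtain ⟨N, s, e, hp, hu⟩ := ih
    by_cases hwit : ∃ k F a, x = wit k F a ∧ Continuous F
    · obtain ⟨k, F, a, hxa, hF⟩ := hwit
      obtain ⟨q, hq, hFq⟩ := hS.exists_eq_fiberSup hF (S.map (e ∘ a) s)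
      obtain ⟨s', hs', hs'q⟩ := hS.exists_lift (e ∘ a) s q hq
      let e' : Witness S (n + 1) → Fin (N + 1) := Function.update (Fin.castSucc ∘ e) x (Fin.last N)
      have he' : ∀ {m : ℕ} (b : Fin m → Witness S (n + 1)), (∀ i, b i ≠ x) →
          S.map (e' ∘ b) s' = S.map (e ∘ b) s := fun b hb => by
        rw [← hs', ← S.map_comp]
        congr 1
        funext i
        exact Function.update_of_ne (hb i) _ _
      have hax : ∀ {k : ℕ} (F : S.space (k + 1) → unitInterval) (a : Fin k → Witness S (n + 1)),
          (wit k F a).rank ≤ x.rank → ∀ i, a i ≠ x := fun F a h i hi =>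
        absurd (rank_lt F a i) (not_lt.2 (hi ▸ h))
      refine ⟨N + 1, s', e', ?_, ?_⟩
      · rw [he' const fun i h => by cases h.trans hxa]
        exact hp
      · intro y hy k' F' a' hy' hF'
        rcases Finset.mem_insert.1 hy with hyx | hyu
        · cases hxa.symm.trans (hyx.symm.trans hy')
          have hax := hax F a (by rw [hxa])
          have h1 : e' ∘ Fin.snoc (α := fun _ => Witness S (n + 1)) a x = liftVar (e ∘ a) := by
            funext i
            refine Fin.lastCases ?_ (fun j => ?_) i
            · simp [e', liftVar]
            · simp only [liftVar, Function.comp_apply, Fin.snoc_castSucc]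
              exact Function.update_of_ne (hax j) _ _
          change F (S.map (e' ∘ Fin.snoc (α := fun _ => Witness S (n + 1)) a y) s') =
            S.fiberSup F (S.map (e' ∘ a) s')
          rw [hyx, h1, hs'q, hFq, he' a hax]
        · have hya := hax F' a' (hy' ▸ hmax y hyu)
          have := hu y hyu k' F' a' hy' hF'
          change F' (S.map (e' ∘ Fin.snoc (α := fun _ => Witness S (n + 1)) a' y) s') =
            S.fiberSup F' (S.map (e' ∘ a') s')
          rw [he' a' hya, he']
          · exact this
          · refine fun i => Fin.lastCases ?_ (fun j => ?_) i
            · rw [Fin.snoc_last]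
              exact fun h => hx (h ▸ hyu)
            · rw [Fin.snoc_castSucc]
              exact hya j
    · refine ⟨N, s, e, hp, fun y hy => ?_⟩
      rcases Finset.mem_insert.1 hy with rfl | hyu
      · exact fun k F a h hF => absurd ⟨k, F, a, h, hF⟩ hwit
      · exact hu y hyu

/-- There is a coherent family of types of tuples of formal witnesses which extends a given type and
according to which all formal witnesses are witnesses. -/
theorem exists_family (hS : S.IsOpenHausdorffCat) (p : S.space (n + 1)) :
    ∃ P : ∀ m, (Fin m → Witness S (n + 1)) → S.space m, P (n + 1) const = p ∧
      (∀ {m k : ℕ} (f : Fin m → Fin k) (a : Fin k → Witness S (n + 1)),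
        P m (a ∘ f) = S.map f (P k a)) ∧ ∀ x, IsCorrect P x := by
  have := hS.compact
  have := hS.hausdorff
  have hev : ∀ {m : ℕ} (a : Fin m → Witness S (n + 1)),
      Continuous fun P : ∀ m, (Fin m → Witness S (n + 1)) → S.space m => P m a := fun {m} a =>
    (continuous_apply a).comp (continuous_apply m)
  let K : Set (∀ m, (Fin m → Witness S (n + 1)) → S.space m) :=
    {P | P (n + 1) const = p} ∩ {P | ∀ (m k : ℕ) (f : Fin m → Fin k) (a : Fin k → Witness S (n + 1)),
        P m (a ∘ f) = S.map f (P k a)}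
  have hK : IsClosed K := by
    refine (isClosed_eq (hev _) continuous_const).inter ?_
    simp only [ofPred_forall]
    exact isClosed_iInter fun m => isClosed_iInter fun k => isClosed_iInter fun f =>
      isClosed_iInter fun a => isClosed_eq (hev _) ((S.map_continuous f).comp (hev a))
  have hx : ∀ x : Witness S (n + 1), IsClosed {P | IsCorrect P x} := by
    intro x
    simp only [IsCorrect, ofPred_forall]
    exact isClosed_iInter fun k => isClosed_iInter fun F => isClosed_iInter fun a =>
      isClosed_iInter fun _ => isClosed_iInter fun hF =>
        isClosed_eq (hF.comp (hev _)) ((hS.continuous_fiberSup hF).comp (hev a))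
  -- Coherence and correctness are closed conditions in a product of compact spaces; a finite stage
  -- meets finitely many of them at once.
  obtain ⟨P, hP, hP'⟩ := hK.isCompact.inter_iInter_nonempty _ hx fun u => by
    obtain ⟨N, s, e, h1, h2⟩ := exists_finite_stage hS p u
    refine ⟨fun _ a => S.map (e ∘ a) s, ⟨h1, fun m k f a => S.map_comp f (e ∘ a) s⟩, ?_⟩
    exact mem_iInter₂.2 h2
  exact ⟨P, hP.1, fun f a => hP.2 _ _ f a, fun x => mem_iInter.1 hP' x⟩

end Witness

namespace PredicateSystem

variable (D : PredicateSystem S)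

/-- The prestructure on a set given by a coherent family of types of its tuples. -/
def preStructure {X : Type u} (hX : Nonempty X) (P : ∀ m, (Fin m → X) → S.space m)
    (hP : ∀ {m k : ℕ} (f : Fin m → Fin k) (a : Fin k → X), P m (a ∘ f) = S.map f (P k a)) :
    PreStructure D.signature X where
  nonempty := hX
  func f := PEmpty.elim f
  pred R a := R.1 (P _ a)
  dist_self a := by
    have h : ![a, a] = ![a] ∘ ![0, 0] := by funext i; fin_cases i <;> rfl
    have := (D.isMetric.eq_zero_iff (P 2 ![a, a])).2 (by rw [h, hP]; exact isDiagonal_refl _ _)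
    exact congrArg Subtype.val this
  dist_comm a b := by
    have h : ![b, a] = ![a, b] ∘ ![1, 0] := by funext i; fin_cases i <;> rfl
    have := D.isMetric.symm (P 2 ![a, b])
    rw [← hP, ← h] at this
    exact congrArg Subtype.val this.symm
  dist_triangle a b c := by
    have h1 : ![a, c] = ![a, b, c] ∘ ![0, 2] := by funext i; fin_cases i <;> rfl
    have h2 : ![a, b] = ![a, b, c] ∘ ![0, 1] := by funext i; fin_cases i <;> rfl
    have h3 : ![b, c] = ![a, b, c] ∘ ![1, 2] := by funext i; fin_cases i <;> rfl
    have := D.isMetric.triangle (P 3 ![a, b, c])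
    rwa [← hP, ← hP, ← hP, ← h1, ← h2, ← h3] at this
  func_uc f := PEmpty.elim f
  pred_uc {k} R i ε hε a z w h := by
    -- One tuple containing both `z`, in position `i`, and `w`, in the last, so that `modulus_spec`
    -- applies to its type.
    let b : Fin (k + 1) → X := Fin.snoc (α := fun _ => X) (Function.update a i z) w
    have h1 : b ∘ ![i.castSucc, Fin.last k] = ![z, w] := by
      funext j; fin_cases j <;> simp [b, -Fin.snoc_update]
    have h2 : b ∘ Fin.castSucc = Function.update a i z := Fin.snoc_comp_castSucc
    have h3 : b ∘ Function.update Fin.castSucc i (Fin.last k) = Function.update a i w := by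
      funext j
      by_cases hj : j = i
      · subst hj; simp [b, -Fin.snoc_update]
      · simp [b, hj, -Fin.snoc_update]
    have := D.modulus_spec R i ε hε (P _ b)
    rw [← hP, ← hP, ← hP, h1, h2, h3] at this
    exact this h

/-- In the prestructure of formal witnesses, `wit k F a` attains the fibrewise supremum of `F`, so
quantifiers over elements agree with quantifiers over types. The variable `x_0` ensures
nonemptiness. -/
theorem exists_realisation_succ {n : ℕ} (p : S.space (n + 1)) :
    ∃ (M : Type u) (𝓜 : ContStructure D.signature M) (a : Fin (n + 1) → M),
      𝓜.Models D.theory ∧ ∀ φ, D.interp φ p = 𝓜.eval φ a := by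
  obtain ⟨P, hp, hP, hwit⟩ := Witness.exists_family D.isCat p
  let 𝓧 := D.preStructure ⟨.const 0⟩ P hP
  have hsup : ∀ {k : ℕ} {F : S.space (k + 1) → unitInterval}, Continuous F →
      ∀ a : Fin k → Witness S (n + 1),
        supI (fun b => F (P (k + 1) (Fin.snoc (α := fun _ => Witness S (n + 1)) a b))) =
          S.fiberSup F (P k a) := by
    intro k F hF a
    refine le_antisymm (supI_le fun b => ?_) ?_
    · have := le_fiberSup F (P (k + 1) (Fin.snoc (α := fun _ => Witness S (n + 1)) a b))
      rwa [← hP, Fin.snoc_comp_castSucc] at this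
    · rw [← hwit (.wit k F a) k F a rfl hF]
      exact le_supI (fun b => F (P (k + 1) (Fin.snoc (α := fun _ => Witness S (n + 1)) a b))) _
  have hterm : ∀ {k : ℕ} (a : Fin k → Witness S (n + 1))
      (t : D.signature.toLanguage.Term (Fin k)), 𝓧.termVal a t = a (D.termVar t) := by
    intro k a t
    cases t with
    | var i => rfl
    | func f _ => exact PEmpty.elim f
  have heval : ∀ {k : ℕ} (φ : Formula D.signature k) (a : Fin k → Witness S (n + 1)),
      𝓧.eval φ a = D.interp φ (P k a) := by
    intro k φ a
    induction φ with
    | pred R t =>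
      simp only [PreStructure.eval, interp, hterm, ← hP]
      rfl
    | neg φ ih => simp only [PreStructure.eval, interp, ih]
    | half φ ih => simp only [PreStructure.eval, interp, ih]
    | dotminus φ ψ ih₁ ih₂ => simp only [PreStructure.eval, interp, ih₁, ih₂]
    | sup φ ih =>
      simp only [PreStructure.eval, interp, ih]
      exact hsup (D.continuous_interp φ) a
    | inf φ ih =>
      simp only [PreStructure.eval, interp, ih, infI]
      exact congrArg negI
        (hsup (uniformContinuous_negI.continuous.comp (D.continuous_interp φ)) a)
  obtain ⟨M, 𝓜, e, he⟩ := 𝓧.exists_completion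
  refine ⟨M, 𝓜, e ∘ .const, fun φ hφ => ?_, fun φ => ?_⟩
  · rw [Subsingleton.elim (Fin.elim0 : Fin 0 → M) (e ∘ Fin.elim0), he, heval]
    exact hφ _
  · rw [he, heval, hp]

theorem exists_realisation {n : ℕ} (p : S.space n) :
    ∃ (M : Type u) (𝓜 : ContStructure D.signature M) (a : Fin n → M),
      𝓜.Models D.theory ∧ ∀ φ, D.interp φ p = 𝓜.eval φ a := by
  obtain ⟨q, rfl⟩ := D.isCat.exists_extend p
  obtain ⟨M, 𝓜, a, h𝓜, h⟩ := D.exists_realisation_succ q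
  exact ⟨M, 𝓜, a ∘ Fin.castSucc, h𝓜, fun φ => by
    rw [← D.interp_relabel, h, 𝓜.eval_relabel]⟩

/-- A formula which vanishes on all types vanishes on all tuples of models of the theory. -/
theorem eval_eq_zero {M : Type u} {𝓜 : ContStructure D.signature M} (h𝓜 : 𝓜.Models D.theory)
    {n : ℕ} (φ : Formula D.signature n) (h : ∀ p, D.interp φ p = 0) (a : Fin n → M) :
    𝓜.eval φ a = 0 := by
  induction n with
  | zero =>
    rw [Subsingleton.elim a Fin.elim0]
    exact h𝓜 φ h
  | succ n ih =>
    -- If `φ` vanishes on all types then so does `sup φ`; iterating reaches a sentence of the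
    -- theory.
    have := ih φ.sup (fun p => le_antisymm (fiberSup_le fun q _ => (h q).le)
      unitInterval.nonneg') (a ∘ Fin.castSucc)
    have h1 := le_supI (fun b => 𝓜.eval φ (Fin.snoc (α := fun _ => M) (a ∘ Fin.castSucc) b))
      (a (Fin.last n))
    have h2 : Fin.snoc (α := fun _ => M) (a ∘ Fin.castSucc) (a (Fin.last n)) = a :=
      Fin.snoc_init_self a
    simp only [h2] at h1
    exact le_antisymm (h1.trans_eq this) unitInterval.nonneg'

/-- The map from the types of the cat to the types of its theory. -/
noncomputable def toTypeSpace {n : ℕ} (p : S.space n) : TypeSpace D.theory n :=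
  ⟨fun φ => D.interp φ p, D.exists_realisation p⟩

theorem interp_pred_var {n : ℕ} (F : D.preds n) (p : S.space n) :
    D.interp (.pred F fun i => .var i) p = F.1 p :=
  congrArg F.1 (S.map_id p)

/-- Injective because the atomic formulae separate types; surjective by `exists_eq`, since a tuple
in a model satisfies every condition that holds throughout `S_n`. -/
theorem bijective_toTypeSpace (n : ℕ) :
    Function.Bijective (D.toTypeSpace : S.space n → TypeSpace D.theory n) := by
  have := D.isCat.compact n
  refine ⟨fun p q h => D.separates p q fun F hF => ?_, fun q => ?_⟩
  · exact (D.interp_pred_var ⟨F, hF⟩ p).symm.trans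
      ((congrArg (fun r : TypeSpace D.theory n => r.val (.pred ⟨F, hF⟩ fun i => .var i)) h).trans (D.interp_pred_var ⟨F, hF⟩ q))
  · obtain ⟨M, 𝓜, h𝓜, a, rfl⟩ := q.exists_eq_tp
    obtain ⟨p, hp⟩ := (𝓜.isValuation_eval a).exists_eq
      (Φ := fun (p : S.space n) φ => D.interp φ p) D.isValuation_interp D.continuous_interp
      fun φ h => D.eval_eq_zero h𝓜 φ h a
    exact ⟨p, TypeSpace.ext fun φ => congrFun hp φ⟩

/-- The isomorphism between a metric open Hausdorff cat and the type-space functor of its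
theory. -/
noncomputable def iso : Iso S (typeFunctor D.theory) where
  homeo n :=
    haveI := D.isCat.compact n
    haveI : T2Space ((typeFunctor D.theory).space n) :=
      (inferInstance : T2Space (TypeSpace D.theory n))
    Continuous.homeoOfEquivCompactToT2
      (f := (Equiv.ofBijective D.toTypeSpace (D.bijective_toTypeSpace n) :
        S.space n ≃ (typeFunctor D.theory).space n))
      (continuous_induced_rng.2 (continuous_pi D.continuous_interp))
  natural f p := TypeSpace.ext fun φ => (D.interp_relabel φ f p).symm

theorem typeDist_iso (p : S.space 2) : typeDist D.theory (D.iso.homeo 2 p) = D.dist p :=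
  D.interp_pred_var ⟨D.dist, D.dist_mem⟩ p

end PredicateSystem

/-! ### Bounding the signature -/

/-- The predicate system given by a separating family of continuous functions and a definable
metric. -/
theorem IsOpenHausdorffCat.exists_predicateSystem (hS : S.IsOpenHausdorffCat)
    {d : S.space 2 → unitInterval} (hd : S.IsDefinableMetric d)
    (A : ∀ n, Set (S.space n → unitInterval)) (hA : ∀ n, ∀ F ∈ A n, Continuous F)
    (hsep : ∀ n (p q : S.space n), (∀ F ∈ A n, F p = F q) → p = q) :
    ∃ D : PredicateSystem S, D.dist = d ∧ ∀ n, #(D.preds n) ≤ #(A n) + 1 := by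
  -- `E 2 = {d}` and `E n` is empty otherwise, so adjoining the metric costs at most one symbol per
  -- arity.
  let E : ∀ n, Set (S.space n → unitInterval) := fun n =>
    {F | ∃ h : n = 2, F = fun p => d (cast (congrArg S.space h) p)}
  have hE : ∀ n, ∀ F ∈ E n, Continuous F := by
    rintro n F ⟨rfl, rfl⟩
    exact hd.continuous
  have hcont : ∀ n, ∀ F ∈ A n ∪ E n, Continuous F := fun n F hF =>
    hF.elim (hA n F) (hE n F)
  have hmod : ∀ {k : ℕ} (F : ↥(A k ∪ E k)) (i : Fin k) (ε : ℝ), ∃ δ : ℝ, 0 < ε → 0 < δ ∧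
      ∀ r : S.space (k + 1), (d (S.map ![i.castSucc, Fin.last k] r) : ℝ) < δ →
      |(F.1 (S.map Fin.castSucc r) : ℝ) -
        F.1 (S.map (Function.update Fin.castSucc i (Fin.last k)) r)| ≤ ε := by
    intro k F i ε
    by_cases hε : 0 < ε
    · obtain ⟨δ, h⟩ := hS.exists_modulus hd (hcont k F.1 F.2) i ε hε
      exact ⟨δ, fun _ => h⟩
    · exact ⟨0, fun h => absurd h hε⟩
  choose δ hδ using @hmod
  refine ⟨{ isCat := hS, dist := d, isMetric := hd, preds := fun n => A n ∪ E n
            dist_mem := Or.inr ⟨rfl, rfl⟩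
            continuous := hcont _
            separates := fun p q h => hsep _ p q fun F hF => h F (Or.inl hF)
            modulus := fun F => δ F
            modulus_pos := fun F i ε hε => (hδ F i ε hε).1
            modulus_spec := fun F i ε hε => (hδ F i ε hε).2 }, rfl, fun n => ?_⟩
  refine (mk_union_le _ _).trans (add_le_add le_rfl ?_)
  rw [mk_le_one_iff_set_subsingleton]
  rintro _ ⟨h, rfl⟩ _ ⟨_, rfl⟩
  rfl

theorem PredicateSystem.size_signature_le (D : PredicateSystem S) {κ : Cardinal.{u}} (hκ : ℵ₀ ≤ κ)
    (h : ∀ n, #(D.preds n) ≤ κ) : D.signature.size ≤ κ := by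
  have h1 : IsEmpty (Σ k : ℕ, D.signature.Functions k) := ⟨fun z => PEmpty.elim z.2⟩
  rw [MetricSignature.size, mk_sum, mk_eq_zero, lift_zero, zero_add, mk_sigma, lift_sum]
  refine (sum_le_sum _ (fun _ => κ) fun n => ?_).trans ?_
  · rw [lift_id']
    exact h n
  · rw [sum_const, mk_nat, lift_aleph0, lift_uzero]
    exact (mul_le_mul' hκ le_rfl).trans_eq (mul_eq_self hκ)

theorem IsOpenHausdorffCat.exists_theory (hS : S.IsOpenHausdorffCat)
    {d : S.space 2 → unitInterval} (hd : S.IsDefinableMetric d) {κ : Cardinal.{u}} (hκ : ℵ₀ ≤ κ)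
    (hB : ∀ n : ℕ, ∃ B : Set (Set (S.space n)),
      TopologicalSpace.IsTopologicalBasis B ∧ #B ≤ κ) :
    ∃ (L : MetricSignature.{u}) (T : Set (Formula L 0)) (θ : Iso S (typeFunctor T)),
      (∀ p : S.space 2, typeDist T (θ.homeo 2 p) = d p) ∧ L.size ≤ κ := by
  have := hS.compact
  have := hS.hausdorff
  have hA := fun n => (hB n).elim fun B h => exists_separating_functions hκ h.1 h.2
  choose A hAκ hAc hAs using hA
  obtain ⟨D, rfl, hD⟩ := hS.exists_predicateSystem hd A hAc hAs
  refine ⟨D.signature, D.theory, D.iso, D.typeDist_iso, D.size_signature_le hκ fun n => ?_⟩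
  exact (hD n).trans (add_le_of_le hκ (hAκ n) (one_le_aleph0.trans hκ))

end TypeFunctor

end ContLogic

/-- The first part says that every continuous theory is a metric open Hausdorff cat; the second
that every metric open Hausdorff cat, with any definable `[0,1]`-valued metric, arises in this
way; the third bounds the size of the signature by the weights of the type spaces. -/
theorem mainTheorem8 :
    (∀ (L : ContLogic.MetricSignature.{u}) (T : Set (ContLogic.Formula L 0)),
      (ContLogic.typeFunctor T).IsOpenHausdorffCat ∧
        (ContLogic.typeFunctor T).IsDefinableMetric (ContLogic.typeDist T)) ∧
    (∀ (S : ContLogic.TypeFunctor.{u}) (d : S.space 2 → unitInterval),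
      S.IsOpenHausdorffCat → S.IsDefinableMetric d →
        (∃ (L : ContLogic.MetricSignature.{u}) (T : Set (ContLogic.Formula L 0))
          (θ : ContLogic.TypeFunctor.Iso S (ContLogic.typeFunctor T)),
          ∀ p : S.space 2, ContLogic.typeDist T (θ.homeo 2 p) = d p) ∧
        (∀ κ : Cardinal.{u}, ℵ₀ ≤ κ →
          (∀ n : ℕ, ∃ B : Set (Set (S.space n)),
            TopologicalSpace.IsTopologicalBasis B ∧ #B ≤ κ) →
          ∃ (L : ContLogic.MetricSignature.{u}) (T : Set (ContLogic.Formula L 0))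
            (θ : ContLogic.TypeFunctor.Iso S (ContLogic.typeFunctor T)),
            (∀ p : S.space 2, ContLogic.typeDist T (θ.homeo 2 p) = d p) ∧ L.size ≤ κ)) := by
  refine ⟨fun L T => ⟨ContLogic.isOpenHausdorffCat_typeFunctor T,
    ContLogic.isDefinableMetric_typeDist T⟩, fun S d hS hd => ⟨?_, fun κ hκ hB =>
      hS.exists_theory hd hκ hB⟩⟩
  -- Part (2) follows from (3) for `κ` so large that the family of all open sets is an admissible
  -- basis in every `S_n`.
  let κ : Cardinal.{u} := max ℵ₀ (Cardinal.sum fun n => #(Set (S.space n)))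
  obtain ⟨L, T, θ, hθ, -⟩ := hS.exists_theory hd (κ := κ) (le_max_left _ _) fun n =>
    ⟨_, TopologicalSpace.isTopologicalBasis_opens, (Cardinal.mk_set_le _).trans
      ((Cardinal.le_sum (fun n => #(Set (S.space n))) n).trans (le_max_right _ _))⟩
  exact ⟨L, T, θ, hθ⟩
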